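/- Let $q$ be a power of an odd prime, $A=\mathbb{F}_q[T]$, $k=\mathbb{F}_q(T)$, $k_\infty=\mathbb{F}_q((1/T))$, and let $\mathbf{C}$ be the completion of an algebraic closure of $k_\infty$, with the absolute value extending the one on $k_\infty$ normalized by $|T|=q$. Let $\Omega=\mathbf{C}\smallsetminus k_\infty$. A Drinfeld $A$-module of rank $2$ over $\mathbf{C}$ is a ring homomorphism $\phi:A\to\mathbf{C}\{\tau\}$, $a\mapsto\phi_a$ (where $\tau x=x^q\tau$ for $x\in\mathbf{C}$), such that for $a\neq 0$ the twisted polynomial $\phi_a$ has constant coefficient $a$ and degree $2\deg a$ in $\tau$. If $\phi_T=T\tau^0+g\tau+\Delta\tau^2$, its $j$-invariant is $j(\phi)=g^{q+1}/\Delta$. For $z\in\Omega$ let $\Lambda_z=A+Az$ and $e_z(x)=x\prod_{0\neq\lambda\in\Lambda_z}(1-x/\lambda)$. A Drinfeld module $\phi$ is associated to $\Lambda_z$ if $e_z(ax)=\phi_a(e_z(x))$ for all $a\in A$ and $x\in\mathbf{C}$, where $\sum_n c_n\tau^n$ acts on $\mathbf{C}$ by $x\mapsto\sum_n c_n x^{q^n}$.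 Suppose that $z\in\Omega$ satisfies $az^2+bz+c=0$ with $a,b,c\in A$, $a$ monic, $|b|<|a|\leq|c|$ and $\gcd(a,b,c)=1$ (that is, $z$ lies in the quadratic fundamental domain), and put $d=b^2-4ac$, so that $z=(-b+\sqrt{d})/2a$ for a choice of the square root. Then there is a unique Drinfeld $A$-module $\phi^z$ of rank $2$ associated to $\Lambda_z$, and its $j$-invariant $j(z)=j(\phi^z)$ satisfies: 1. if $|z|=1$, then $|j(z)|\leq 1/q$; 2. if $|z|>1$, then $|j(z)|=B_q^{|z|}$, where $B_q=q^{q}$ if $\deg(d)$ is even, and $B_q=q^{\sqrt{q}(q+1)/2}$ if $\deg(d)$ is odd. -/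

import Mathlib

open Polynomial

noncomputable section

namespace DrinfeldJ

universe u

variable (F : Type u) [Field F]

/-- `k_∞ = F((1/T))`: the completion of `k = F(T)` at the place `∞`. -/
abbrev KInfty : Type u :=
  @RatFunc.CompletionAtInfty F _ (Classical.decEq _)

variable [Fintype F]

theorem one_lt_card_nnreal : (1 : NNReal) < (Fintype.card F : NNReal) := by
  exact_mod_cast Fintype.one_lt_card (α := F)

/-- The valuation of `k_∞` takes the value `exp n` on elements of degree `n`; this real structure
turns `exp n` into `q ^ n`, where `q` is the number of elements of `F`. -/
instance rankOneKInfty :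
    Valuation.RankOne (Valued.v : Valuation (KInfty F) (WithZero (Multiplicative ℤ))) where
  hom' := (WithZeroMulInt.toNNReal
      (ne_of_gt (lt_trans zero_lt_one (one_lt_card_nnreal F)))).comp
    MonoidWithZeroHom.ValueGroup₀.embedding
  strictMono' := (WithZeroMulInt.toNNReal_strictMono (one_lt_card_nnreal F)).comp
    MonoidWithZeroHom.ValueGroup₀.embedding_strictMono
  exists_val_nontrivial := by
    let : DecidableEq (RatFunc F) := Classical.decEq _
    let := RatFunc.inftyValued F
    refine ⟨((RatFunc.X : RatFunc F) : UniformSpace.Completion (RatFunc F)), ?_⟩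
    have h : (Valued.v : Valuation (KInfty F) (WithZero (Multiplicative ℤ)))
        ((RatFunc.X : RatFunc F) : UniformSpace.Completion (RatFunc F)) = WithZero.exp 1 :=
      (Valued.extensionValuation_apply_coe (RatFunc.X : RatFunc F)).trans
        (RatFunc.inftyValuation.X F)
    refine ⟨?_, ?_⟩
    · intro h0
      exact WithZero.exp_ne_zero (h.symm.trans h0)
    · intro h1
      have h2 := h.symm.trans h1
      rw [← WithZero.exp_zero, WithZero.exp_inj] at h2
      exact one_ne_zero h2

/-- The absolute value of `k_∞`, with `|T| = q`. -/
instance normedFieldKInfty : NontriviallyNormedField (KInfty F) :=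
  Valued.toNontriviallyNormedField (KInfty F) (WithZero (Multiplicative ℤ))

instance ultrametricKInfty : IsUltrametricDist (KInfty F) :=
  inferInstanceAs (@IsUltrametricDist (KInfty F)
    (Valued.toNormedField (KInfty F) (WithZero (Multiplicative ℤ))).toMetricSpace.toDist)

instance completeKInfty : CompleteSpace (KInfty F) :=
  letI : DecidableEq (RatFunc F) := Classical.decEq _
  letI := RatFunc.inftyValued F
  inferInstanceAs (CompleteSpace (UniformSpace.Completion (RatFunc F)))

/-- An algebraic closure of `k_∞`. -/
abbrev KInftyAlg : Type u := AlgebraicClosure (KInfty F)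

/-- The unique extension of the absolute value of `k_∞` to its algebraic closure. -/
instance normedFieldKInftyAlg : NormedField (KInftyAlg F) :=
  spectralNorm.normedField (KInfty F) (KInftyAlg F)

instance normedAlgebraKInftyAlg : NormedAlgebra (KInfty F) (KInftyAlg F) :=
  spectralNorm.normedAlgebra (KInfty F) (KInftyAlg F)

/-- `𝐂`: the completion of an algebraic closure of `k_∞`, with its absolute value `‖·‖`. -/
abbrev CInfty : Type u := UniformSpace.Completion (KInftyAlg F)

/-- `A = F[T]` is embedded in `𝐂` through `k = F(T)` and `k_∞`. -/
instance algebraPolynomialCInfty : Algebra F[X] (CInfty F) :=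
  (((algebraMap (KInfty F) (CInfty F)).comp (algebraMap (RatFunc F) (KInfty F))).comp
    (algebraMap F[X] (RatFunc F))).toAlgebra

instance algebraCInfty : Algebra F (CInfty F) :=
  ((algebraMap F[X] (CInfty F)).comp (Polynomial.C : F →+* F[X])).toAlgebra

/-- `n` acts on `𝐂` through the `n`-th iterate of the Frobenius `x ↦ x ^ q`. This is what fixes the
commutation rule `τ x = x ^ q τ` in `SkewPolynomial (CInfty F)`. -/
instance frobeniusAction : MulSemiringAction (Multiplicative ℕ) (CInfty F) where
  smul n x := x ^ (Fintype.card F ^ n.toAdd)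
  one_smul x := by
    change x ^ (Fintype.card F ^ 0) = x
    simp
  mul_smul m n x := by
    change x ^ (Fintype.card F ^ (m.toAdd + n.toAdd)) =
      (x ^ (Fintype.card F ^ n.toAdd)) ^ (Fintype.card F ^ m.toAdd)
    rw [← pow_mul, pow_add, mul_comm]
  smul_zero n := by
    change (0 : CInfty F) ^ (Fintype.card F ^ n.toAdd) = 0
    exact zero_pow (pow_ne_zero _ Fintype.card_ne_zero)
  smul_add n x y := by
    change (x + y) ^ (Fintype.card F ^ n.toAdd) =
      x ^ (Fintype.card F ^ n.toAdd) + y ^ (Fintype.card F ^ n.toAdd)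
    have h : ∀ (m : ℕ) (w : CInfty F),
        (FiniteField.frobeniusAlgHom F (CInfty F))^[m] w = w ^ (Fintype.card F ^ m) := by
      intro m w
      induction m with
      | zero => simp
      | succ m ih =>
        rw [Function.iterate_succ_apply', ih, FiniteField.coe_frobeniusAlgHom]
        change (w ^ Fintype.card F ^ m) ^ Fintype.card F = _
        rw [← pow_mul, ← pow_succ]
    rw [← h, ← h, ← h, iterate_map_add]
  smul_one n := by
    change (1 : CInfty F) ^ (Fintype.card F ^ n.toAdd) = 1
    exact one_pow _
  smul_mul n x y := by
    change (x * y) ^ (Fintype.card F ^ n.toAdd) =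
      x ^ (Fintype.card F ^ n.toAdd) * y ^ (Fintype.card F ^ n.toAdd)
    exact mul_pow _ _ _

/-- `𝐂{τ}`: the twisted polynomials `∑ cₙ τⁿ`, with `τ x = x ^ q τ`. -/
abbrev Twisted : Type u := SkewPolynomial (CInfty F)

variable {F} in
/-- The additive polynomial map `x ↦ ∑ cₙ x ^ (q ^ n)` given by the twisted polynomial
`∑ cₙ τⁿ`. -/
def Twisted.eval (p : Twisted F) (x : CInfty F) : CInfty F :=
  p.sum fun n c => c * x ^ (Fintype.card F ^ n)

/-- A Drinfeld `A`-module of rank `r` over `𝐂`: a ring homomorphism `a ↦ φ_a` from `A` to `𝐂{τ}`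
such that `φ_a = a τ⁰ + ⋯ + aₙ τⁿ` with `aₙ ≠ 0` and `n = r deg a`, for `a ≠ 0`.
It is automatically injective, since `φ_a` has constant coefficient `a`. -/
@[ext]
structure DrinfeldModule (r : ℕ) where
  toRingHom : F[X] →+* Twisted F
  coeff_zero : ∀ a, (toRingHom a).coeff 0 = algebraMap F[X] (CInfty F) a
  coeff_top : ∀ a, a ≠ 0 → (toRingHom a).coeff (r * a.natDegree) ≠ 0
  coeff_above : ∀ a n, r * a.natDegree < n → (toRingHom a).coeff n = 0

variable {F} in
/-- The `j`-invariant `g ^ (q + 1) / Δ` of the rank two Drinfeld module with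
`φ_T = T τ⁰ + g τ + Δ τ²`. -/
def DrinfeldModule.j (φ : DrinfeldModule F 2) : CInfty F :=
  (φ.toRingHom X).coeff 1 ^ (Fintype.card F + 1) / (φ.toRingHom X).coeff 2

variable {F} in
/-- The exponential function `e_Λ(x) = x ∏_{0 ≠ l ∈ Λ} (1 - x / l)` of a lattice `Λ` in `𝐂`. -/
def latticeExp (Λ : Submodule F[X] (CInfty F)) (x : CInfty F) : CInfty F :=
  x * ∏' l : {l : CInfty F // l ∈ Λ ∧ l ≠ 0}, (1 - x / l.1)

variable {F} in
/-- `φ` is the Drinfeld module associated to the lattice `Λ`: the functional equation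
`e_Λ(a x) = φ_a(e_Λ(x))` holds for all `a` in `A` and `x` in `𝐂`. -/
def DrinfeldModule.IsAssociated {r : ℕ} (φ : DrinfeldModule F r)
    (Λ : Submodule F[X] (CInfty F)) : Prop :=
  ∀ (a : F[X]) (x : CInfty F),
    latticeExp Λ (algebraMap F[X] (CInfty F) a * x) = (φ.toRingHom a).eval (latticeExp Λ x)

/-- Drinfeld's upper half-plane `Ω = 𝐂 ∖ k_∞`. -/
def upperHalfPlane : Set (CInfty F) :=
  {z | z ∉ Set.range (algebraMap (KInfty F) (CInfty F))}

variable {F} in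
/-- The lattice `⟨1, z⟩ = A + A z`. -/
def latticeOf (z : CInfty F) : Submodule F[X] (CInfty F) :=
  Submodule.span F[X] {1, z}

variable {F} in
/-- `a z² + b z + c = 0` with `a` monic, `|b| < |a| ≤ |c|` and `gcd(a, b, c) = 1`. -/
structure IsReducedEquation (a b c : F[X]) (z : CInfty F) : Prop where
  equation : algebraMap F[X] (CInfty F) a * z ^ 2 + algebraMap F[X] (CInfty F) b * z
    + algebraMap F[X] (CInfty F) c = 0
  monic : a.Monic
  norm_lt : ‖algebraMap F[X] (CInfty F) b‖ < ‖algebraMap F[X] (CInfty F) a‖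
  norm_le : ‖algebraMap F[X] (CInfty F) a‖ ≤ ‖algebraMap F[X] (CInfty F) c‖
  gcd_eq_one : ∀ e : F[X], e ∣ a → e ∣ b → e ∣ c → IsUnit e

/-- The quadratic fundamental domain. -/
def quadraticFundamentalDomain : Set (CInfty F) :=
  {z | z ∈ upperHalfPlane F ∧ ∃ a b c : F[X], IsReducedEquation a b c z}

/-- `B_q`, as a function of `q` and of the degree of `d`. -/
def boundBase (q n : ℕ) : ℝ :=
  if Even n then (q : ℝ) ^ (q : ℝ) else (q : ℝ) ^ (Real.sqrt q * (q + 1) / 2)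

end DrinfeldJ

end

noncomputable section

namespace DrinfeldJ

open Filter Topology

universe u

/-! ### The absolute value of `𝐂` -/

section Concrete

variable (F : Type u) [Field F] [Fintype F]

/-! The lattice `A + A z` is orthogonal: `|α + β z| = max |α| |β z|` for polynomials `α`, `β`
(`IsReducedEquation.isReduced`). If some `y` in `k_∞` had `|z - y| < |z|`, the ratio of `2az + b`, a
square root of `d`, to `2ay + b` would be a one-unit with square in `k_∞`. As `q` is odd, the ratio
itself would lie in `k_∞`, and so would `z`.

The exponential `e` is the limit of the finite products `e_n` over the points `α + β z` with
coefficients of degree less than `n`. Splitting off the constant terms of `α` and `β` gives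
`e_{n+1}(T x) = P_n(e_n(x))`, where `P_n` is the additive polynomial with linear coefficient `T` and
kernel spanned over `F` by `e_n(1/T)` and `e_n(z/T)` (`IsReduced.boxExp_succ`). This makes each
`e_n` `F`-linear by induction and, in the limit, yields `φ_T = T + g τ + Δ τ²` with kernel spanned
by `w₁ = e(1/T)` and `w₂ = e(z/T)`. Uniqueness holds because `e` takes infinitely many values. With
`L = w₂^q - w₁^(q-1) w₂` and `N = w₁^(q(q-1)) + L^(q-1)` one has `Δ = T / (w₁ L)^(q-1)` and `g = -N
Δ`, so `|j| = |N|^(q+1) |Δ|^q` (`IsReduced.existsUnique_isAssociated`).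

It remains to measure `w₁` and `w₂`; always `|w₁| = 1/q`. If `|z| > 1`, orthogonality turns `|w₂|`
into an explicit product, whose value `E` becomes `(q E)^q` when `|z|` is multiplied by `q`
(`IsReduced.boxNorm_succ`). As `w₂` dominates `w₁`, `|j| = q^(q²) E^(q(q-1))`. This is raised to the
power `q` when `|z|` is multiplied by `q`, as is `B_q^|z|`, so only the smallest values `|z| = q`
and `|z| = √q` need checking; the parity of `deg d` decides between them because `|z|² = |d| /
|a|²`.

If `|z| = 1`, then `z²` is congruent to a constant, which is a nonsquare by orthogonality, so
`z^(q-1) ≡ -1` by Euler's criterion. The leading terms of `N` then cancel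
(`IsReducedEquation.norm_le_of_norm_eq_one`), which gives the upper bound. -/

instance ultrametricKInftyAlg : IsUltrametricDist (KInftyAlg F) :=
  IsUltrametricDist.isUltrametricDist_of_isNonarchimedean_norm
    (isNonarchimedean_spectralNorm (K := KInfty F) (L := KInftyAlg F))

instance ultrametricCInfty : IsUltrametricDist (CInfty F) := by
  refine IsUltrametricDist.isUltrametricDist_of_isNonarchimedean_norm fun x y => ?_
  induction x, y using UniformSpace.Completion.induction_on₂ with
  | hp => exact isClosed_le (by fun_prop) (by fun_prop)
  | ih x y =>
    rw [← UniformSpace.Completion.coe_add, UniformSpace.Completion.norm_coe,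
      UniformSpace.Completion.norm_coe, UniformSpace.Completion.norm_coe]
    exact IsUltrametricDist.norm_add_le_max x y

variable {F}

theorem norm_kInfty_polynomial {p : F[X]} (hp : p ≠ 0) :
    ‖algebraMap (RatFunc F) (KInfty F) (algebraMap F[X] (RatFunc F) p)‖ =
      (Fintype.card F : ℝ) ^ p.natDegree := by
  have hv : (Valued.v : Valuation (KInfty F) (WithZero (Multiplicative ℤ)))
      (algebraMap (RatFunc F) (KInfty F) (algebraMap F[X] (RatFunc F) p)) =
        WithZero.exp (p.natDegree : ℤ) := by
    let : DecidableEq (RatFunc F) := Classical.decEq _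
    let := RatFunc.inftyValued F
    exact (Valued.extensionValuation_apply_coe (algebraMap F[X] (RatFunc F) p)).trans
      (RatFunc.inftyValuation.polynomial F hp)
  have hn : ‖algebraMap (RatFunc F) (KInfty F) (algebraMap F[X] (RatFunc F) p)‖ =
      (WithZeroMulInt.toNNReal (ne_of_gt (lt_trans zero_lt_one (one_lt_card_nnreal F)))
        ((Valued.v : Valuation (KInfty F) (WithZero (Multiplicative ℤ)))
      (algebraMap (RatFunc F) (KInfty F) (algebraMap F[X] (RatFunc F) p))) : ℝ) := by
    rw [← Valuation.embedding_restrict]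
    rfl
  rw [hn, hv, WithZeroMulInt.toNNReal_neg_apply _ WithZero.exp_ne_zero]
  simp [WithZero.exp]

theorem norm_algebraMap_polynomial {p : F[X]} (hp : p ≠ 0) :
    ‖algebraMap F[X] (CInfty F) p‖ = (Fintype.card F : ℝ) ^ p.natDegree :=
  (norm_algebraMap' (CInfty F) _).trans (norm_kInfty_polynomial hp)

theorem isClosed_range_kInfty : IsClosed (Set.range (algebraMap (KInfty F) (CInfty F))) :=
  (algebraMap_isometry (KInfty F) (CInfty F)).isClosedEmbedding.isClosed_range

end Concrete

/-! ### Additive polynomials whose kernel is a plane over the finite field -/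

section Moore

variable {F K : Type*} [Field F] [Fintype F] [Field K] [Algebra F K]

local notation "q" => Fintype.card F

variable (F) in
theorem add_pow_card (x y : K) : (x + y) ^ q = x ^ q + y ^ q :=
  map_add (FiniteField.frobeniusAlgHom F K) x y

variable (F) in
theorem sub_pow_card (x y : K) : (x - y) ^ q = x ^ q - y ^ q :=
  map_sub (FiniteField.frobeniusAlgHom F K) x y

theorem algebraMap_pow_card (b : F) : algebraMap F K b ^ q = algebraMap F K b := by
  rw [← map_pow, FiniteField.pow_card]

variable (F) in
theorem card_sub_one_add_one : q - 1 + 1 = q := Nat.succ_pred_eq_of_pos Fintype.card_pos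

variable (F) in
theorem card_sub_one_ne_zero : q - 1 ≠ 0 := by
  have := Fintype.one_lt_card (α := F)
  omega

variable (F) in
/-- The polynomial `x ^ q - w ^ (q - 1) x`, whose roots are the `F`-multiples of `w`. -/
def linePoly (w x : K) : K := x ^ q - w ^ (q - 1) * x

theorem linePoly_sub_smul (w x y : K) (c : F) :
    linePoly F w (x - algebraMap F K c * y) =
      linePoly F w x - algebraMap F K c * linePoly F w y := by
  simp only [linePoly, sub_pow_card F, mul_pow, algebraMap_pow_card]
  ring

variable (F) in
/-- The coefficient `Δ` of the additive polynomial with linear coefficient `t` and kernel spanned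
by `w₁` and `w₂`. -/
def planeDelta (t w₁ w₂ : K) : K := t / (w₁ ^ (q - 1) * linePoly F w₁ w₂ ^ (q - 1))

variable (F) in
/-- The coefficient `g` of the additive polynomial with linear coefficient `t` and kernel spanned
by `w₁` and `w₂`. -/
def planeG (t w₁ w₂ : K) : K :=
  -((w₁ ^ (q - 1)) ^ q + linePoly F w₁ w₂ ^ (q - 1)) * planeDelta F t w₁ w₂

variable (F) in
/-- The additive polynomial with linear coefficient `t` and kernel spanned by `w₁` and `w₂`. -/
def planePoly (t w₁ w₂ x : K) : K :=
  t * x + planeG F t w₁ w₂ * x ^ q + planeDelta F t w₁ w₂ * x ^ q ^ 2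

theorem planePoly_add (t w₁ w₂ x y : K) :
    planePoly F t w₁ w₂ (x + y) = planePoly F t w₁ w₂ x + planePoly F t w₁ w₂ y := by
  simp only [planePoly, pow_two, pow_mul, add_pow_card F]
  ring

theorem planePoly_smul (t w₁ w₂ x : K) (c : F) :
    planePoly F t w₁ w₂ (algebraMap F K c * x) = algebraMap F K c * planePoly F t w₁ w₂ x := by
  simp only [planePoly, pow_two, pow_mul, mul_pow, algebraMap_pow_card]
  ring

variable [DecidableEq F]

/-- This is the homogeneous form of `X^(q-1) - 1 = ∏ (X - b)`, evaluated at `x / w`. -/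
theorem prod_sub_smul_erase_zero (w x : K) :
    ∏ b ∈ Finset.univ.erase (0 : F), (x - algebraMap F K b * w) = x ^ (q - 1) - w ^ (q - 1) := by
  have hcard : (Finset.univ.erase (0 : F)).card = q - 1 := by
    rw [Finset.card_erase_of_mem (Finset.mem_univ _), Finset.card_univ]
  rcases eq_or_ne w 0 with rfl | hw
  · simp [hcard, zero_pow (card_sub_one_ne_zero F)]
  have key : ∏ b : F, (X - C b) = (X ^ q - X : F[X]) := by
    have h := FiniteField.X_pow_card_sub_X_natDegree_eq F (Fintype.one_lt_card (α := F))
    have := prod_multiset_X_sub_C_of_monic_of_roots_card_eq (p := (X ^ q - X : F[X]))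
      (monic_X_pow_sub (by
        simpa using! Fintype.one_lt_card (α := F)))
      (by rw [FiniteField.roots_X_pow_card_sub_X, h]; rfl)
    rw [FiniteField.roots_X_pow_card_sub_X] at this
    exact this
  have key2 : ∏ b ∈ Finset.univ.erase (0 : F), (X - C b) = (X ^ (q - 1) - 1 : F[X]) := by
    apply mul_left_cancel₀ (X_ne_zero (R := F))
    rw [← Finset.mul_prod_erase _ _ (Finset.mem_univ (0 : F)), C_0, sub_zero] at key
    rw [key, mul_sub, mul_one, ← pow_succ', card_sub_one_add_one]
  have h := congrArg (aeval (x / w)) key2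
  simp only [map_prod, map_sub, aeval_X, aeval_C, map_pow, map_one] at h
  calc ∏ b ∈ Finset.univ.erase (0 : F), (x - algebraMap F K b * w)
      = ∏ b ∈ Finset.univ.erase (0 : F), w * (x / w - algebraMap F K b) := by
        refine Finset.prod_congr rfl fun b _ => ?_
        field_simp
    _ = _ := by
        rw [Finset.prod_mul_distrib, h, Finset.prod_const, hcard, div_pow]
        field_simp

theorem prod_sub_smul (w x : K) : ∏ b : F, (x - algebraMap F K b * w) = linePoly F w x := by
  rw [← Finset.mul_prod_erase _ _ (Finset.mem_univ (0 : F)), prod_sub_smul_erase_zero, linePoly,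
    map_zero, zero_mul, sub_zero, mul_sub, ← pow_succ', card_sub_one_add_one, mul_comm x]

theorem prod_erase_zero_prod {M : Type*} [CommMonoid M] (f : F × F → M) :
    ∏ b ∈ Finset.univ.erase (0 : F × F), f b =
      (∏ b ∈ Finset.univ.erase (0 : F), f (b, 0)) *
        ∏ c ∈ Finset.univ.erase (0 : F), ∏ b : F, f (b, c) := by
  have h1 : ∀ (g : F × F → M), ∏ b : F × F, g b =
      (∏ b : F, g (b, 0)) * ∏ c ∈ Finset.univ.erase (0 : F), ∏ b : F, g (b, c) := fun g => by
    rw [Fintype.prod_prod_type_right, ← Finset.mul_prod_erase _ _ (Finset.mem_univ (0 : F))]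
  have h2 : ∀ {B : Type _} [Fintype B] [DecidableEq B] [Zero B] (g : B → M),
      ∏ b ∈ Finset.univ.erase (0 : B), g b = ∏ b : B, if b = 0 then 1 else g b := fun g => by
    rw [← Finset.mul_prod_erase _ _ (Finset.mem_univ 0), if_pos rfl, one_mul]
    exact Finset.prod_congr rfl fun b hb => by rw [if_neg (Finset.ne_of_mem_erase hb)]
  rw [h2, h1, h2 fun b => f (b, 0)]
  congr 1
  · simp [Prod.ext_iff]
  · refine Finset.prod_congr rfl fun c hc => Finset.prod_congr rfl fun b _ => ?_
    rw [if_neg fun h => Finset.ne_of_mem_erase hc (congrArg Prod.snd h)]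

/-- The product over a coset of the line `F w₁` is a value of `linePoly F w₁`. By linearity the
cosets `c w₂` give `linePoly F w₁ x - c * linePoly F w₁ w₂`, and the line formula applies a second
time. -/
theorem prod_sub_plane_erase_zero (w₁ w₂ x : K) :
    ∏ b ∈ Finset.univ.erase (0 : F × F),
      (x - (algebraMap F K b.1 * w₁ + algebraMap F K b.2 * w₂)) =
    (x ^ (q - 1) - w₁ ^ (q - 1)) *
      (linePoly F w₁ x ^ (q - 1) - linePoly F w₁ w₂ ^ (q - 1)) := by
  rw [prod_erase_zero_prod]
  congr 1
  · rw [← prod_sub_smul_erase_zero]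
    simp
  · rw [← prod_sub_smul_erase_zero]
    refine Finset.prod_congr rfl fun c _ => ?_
    rw [← linePoly_sub_smul, ← prod_sub_smul]
    exact Finset.prod_congr rfl fun b _ => by ring

theorem linePoly_ne_zero {w₁ w₂ : K}
    (h : ∀ b : F × F, b ≠ 0 → algebraMap F K b.1 * w₁ + algebraMap F K b.2 * w₂ ≠ 0) :
    linePoly F w₁ w₂ ≠ 0 := by
  rw [← prod_sub_smul, Finset.prod_ne_zero_iff]
  intro b _ h0
  refine h (-b, 1) (by simp [Prod.ext_iff]) ?_
  rw [map_neg, map_one, ← h0]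
  ring

theorem prod_one_sub_div_plane {w₁ w₂ : K} (t x : K)
    (h : ∀ b : F × F, b ≠ 0 → algebraMap F K b.1 * w₁ + algebraMap F K b.2 * w₂ ≠ 0) :
    t * x * ∏ b ∈ Finset.univ.erase (0 : F × F),
      (1 - x / (algebraMap F K b.1 * w₁ + algebraMap F K b.2 * w₂)) = planePoly F t w₁ w₂ x := by
  have hw₁ : w₁ ≠ 0 := by simpa using h (1, 0) (by simp [Prod.ext_iff])
  have hD := linePoly_ne_zero h
  have h1 : ∏ b ∈ Finset.univ.erase (0 : F × F),
      (1 - x / (algebraMap F K b.1 * w₁ + algebraMap F K b.2 * w₂)) =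
      ((x ^ (q - 1) - w₁ ^ (q - 1)) *
      (linePoly F w₁ x ^ (q - 1) - linePoly F w₁ w₂ ^ (q - 1))) /
      (w₁ ^ (q - 1) * linePoly F w₁ w₂ ^ (q - 1)) := by
    -- The value at `x = 0` is the product of the negated roots, which normalizes the factors to `1
    -- - x / l`.
    have h0 := prod_sub_plane_erase_zero (F := F) w₁ w₂ 0
    have hl : linePoly F w₁ 0 = 0 := by simp [linePoly]
    rw [hl, zero_pow (card_sub_one_ne_zero F), zero_sub, zero_sub, neg_mul_neg] at h0
    rw [← h0, ← prod_sub_plane_erase_zero, ← Finset.prod_div_distrib]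
    refine Finset.prod_congr rfl fun b hb => ?_
    have := h b (Finset.ne_of_mem_erase hb)
    rw [zero_sub, div_neg, sub_div, div_self this]
    ring
  -- The plane polynomial is a composite of two line polynomials.
  have h2 : x * ((x ^ (q - 1) - w₁ ^ (q - 1)) *
      (linePoly F w₁ x ^ (q - 1) - linePoly F w₁ w₂ ^ (q - 1))) =
      linePoly F w₁ x ^ q - linePoly F w₁ w₂ ^ (q - 1) * linePoly F w₁ x := by
    have h3 : x * (x ^ (q - 1) - w₁ ^ (q - 1)) = linePoly F w₁ x := by
      rw [linePoly, mul_sub, ← pow_succ', card_sub_one_add_one, mul_comm x]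
    rw [← mul_assoc, h3, mul_sub, ← pow_succ', card_sub_one_add_one, mul_comm _ (linePoly F w₁ x)]
  rw [h1, mul_assoc, mul_div_assoc', h2]
  have h4 : linePoly F w₁ x ^ q = x ^ q ^ 2 - (w₁ ^ (q - 1)) ^ q * x ^ q := by
    rw [linePoly, sub_pow_card F, mul_pow, pow_two, pow_mul]
  rw [h4, planePoly, planeG, planeDelta]
  have hl : linePoly F w₁ x = x ^ q - w₁ ^ (q - 1) * x := rfl
  have hA : w₁ ^ (q - 1) ≠ 0 := pow_ne_zero _ hw₁
  have hB : linePoly F w₁ w₂ ^ (q - 1) ≠ 0 := pow_ne_zero _ hD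
  rw [hl]
  generalize w₁ ^ (q - 1) = A at *
  generalize linePoly F w₁ w₂ ^ (q - 1) = B at *
  field_simp
  ring

end Moore

/-! ### Lattice points and finite exponential products -/

section Lattice

variable {F : Type*} [Field F]

theorem C_add_X_mul_inj {b c : F} {v w : F[X]} (h : C b + X * v = C c + X * w) :
    b = c ∧ v = w := by
  obtain rfl : b = c := by simpa using congrArg (eval 0) h
  exact ⟨rfl, mul_left_cancel₀ X_ne_zero (add_left_cancel h)⟩

variable {K : Type*} [NormedField K] [Algebra F[X] K]

/-- The element `α + β z` of the lattice spanned by `1` and `z`. -/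
def latticePoint (z : K) (v : F[X] × F[X]) : K :=
  algebraMap F[X] K v.1 + algebraMap F[X] K v.2 * z

theorem latticePoint_sub (z : K) (v w : F[X] × F[X]) :
    latticePoint z (v - w) = latticePoint z v - latticePoint z w := by
  simp only [latticePoint, Prod.fst_sub, Prod.snd_sub, map_sub]
  ring

theorem latticePoint_neg (z : K) (v : F[X] × F[X]) :
    latticePoint z (-v) = -latticePoint z v := by
  simp only [latticePoint, Prod.fst_neg, Prod.snd_neg, map_neg]
  ring

theorem latticePoint_zero (z : K) : latticePoint z (0 : F[X] × F[X]) = 0 := by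
  simp [latticePoint]

theorem latticePoint_digit (z : K) (b : F × F) (v : F[X] × F[X]) :
    latticePoint z (C b.1 + X * v.1, C b.2 + X * v.2) =
      latticePoint z (C b.1, C b.2) + algebraMap F[X] K X * latticePoint z v := by
  simp only [latticePoint, map_add, map_mul]
  ring

variable [Fintype F]

local notation "q" => Fintype.card F

open scoped Classical in
variable (F) in
/-- The pairs of polynomials of degree less than `n`. -/
def box : ℕ → Finset (F[X] × F[X])
  | 0 => {0}
  | n + 1 => (Finset.univ ×ˢ box n).image
      fun p : (F × F) × (F[X] × F[X]) => (C p.1.1 + X * p.2.1, C p.1.2 + X * p.2.2)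

theorem prod_box_succ {M : Type*} [CommMonoid M] (n : ℕ) (f : F[X] × F[X] → M) :
    ∏ v ∈ box F (n + 1), f v =
      ∏ b : F × F, ∏ v ∈ box F n, f (C b.1 + X * v.1, C b.2 + X * v.2) := by
  classical
  rw [box, Finset.prod_image, Finset.prod_product]
  rintro ⟨b, v⟩ - ⟨c, w⟩ - h
  obtain ⟨h1, h2⟩ := Prod.mk.inj h
  have := C_add_X_mul_inj h1
  have := C_add_X_mul_inj h2
  simp_all [Prod.ext_iff]

theorem zero_mem_box (n : ℕ) : (0 : F[X] × F[X]) ∈ box F n := by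
  classical
  induction n with
  | zero => simp [box]
  | succ n ih =>
    rw [box, Finset.mem_image]
    exact ⟨(0, 0), by simpa using ih, by simp⟩

theorem mem_box_of_natDegree_lt {n : ℕ} {v : F[X] × F[X]} (h₁ : v.1.natDegree < n)
    (h₂ : v.2.natDegree < n) : v ∈ box F n := by
  classical
  induction n generalizing v with
  | zero => omega
  | succ n ih =>
    rw [box, Finset.mem_image]
    refine ⟨((v.1.coeff 0, v.2.coeff 0), (v.1.divX, v.2.divX)), ?_, ?_⟩
    · rw [Finset.mem_product]
      refine ⟨Finset.mem_univ _, ?_⟩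
      rcases n with _ | n
      · have e1 : v.1.divX = 0 := by
          rw [eq_C_of_natDegree_eq_zero (p := v.1) (by omega), divX_C]
        have e2 : v.2.divX = 0 := by
          rw [eq_C_of_natDegree_eq_zero (p := v.2) (by omega), divX_C]
        simp [box, e1, e2]
      · refine ih ?_ ?_ <;> simp only [natDegree_divX_eq_natDegree_tsub_one] <;> omega
    · ext1
      · exact (add_comm _ _).trans (X_mul_divX_add v.1)
      · exact (add_comm _ _).trans (X_mul_divX_add v.2)

theorem box_mono : Monotone (box F) := by
  classical
  refine monotone_nat_of_le_succ fun n => ?_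
  induction n with
  | zero =>
    intro v hv
    rw [box, Finset.mem_singleton] at hv
    exact hv ▸ zero_mem_box 1
  | succ n ih =>
    rw [box, box]
    exact Finset.image_subset_image (Finset.product_subset_product_right ih)

theorem prod_box_neg {M : Type*} [CommMonoid M] (n : ℕ) (f : F[X] × F[X] → M) :
    ∏ v ∈ box F n, f (-v) = ∏ v ∈ box F n, f v := by
  induction n generalizing f with
  | zero => simp [box]
  | succ n ih =>
    rw [prod_box_succ, prod_box_succ]
    refine Fintype.prod_equiv (Equiv.neg (F × F)) _ _ fun b => ?_
    rw [← ih]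
    refine Finset.prod_congr rfl fun v _ => congrArg f ?_
    ext1 <;> simp [add_comm]

/-- The finite product `x ∏ (1 - x / l)` over the nonzero `l = α + β z` with `α` and `β` of degree
less than `n`. The factor of `l = 0` is `1`, as `x / 0 = 0`. -/
def boxExp (F : Type*) [Field F] [Fintype F] [Algebra F[X] K] (z : K) (n : ℕ) (x : K) : K :=
  x * ∏ v ∈ box F n, (1 - x / latticePoint z v)

theorem boxExp_zero (z x : K) : boxExp F z 0 x = x := by
  simp [boxExp, box, latticePoint_zero]

/-- `z` is reduced: `|α + β z| = max |α| |β z|` for polynomials `α` and `β`, `|z| ≥ 1`, and the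
absolute value is normalized by `|T| = q`. -/
structure IsReduced (F : Type*) [Field F] [Fintype F] [Algebra F[X] K] (z : K) : Prop where
  norm_poly : ∀ p : F[X], p ≠ 0 → ‖algebraMap F[X] K p‖ = (Fintype.card F : ℝ) ^ p.natDegree
  one_le : 1 ≤ ‖z‖
  norm_point : ∀ v : F[X] × F[X],
    ‖latticePoint z v‖ = max ‖algebraMap F[X] K v.1‖ (‖algebraMap F[X] K v.2‖ * ‖z‖)

variable (F) in
theorem one_lt_card_real : (1 : ℝ) < q := by exact_mod_cast Fintype.one_lt_card (α := F)

namespace IsReduced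

variable {z : K} (hz : IsReduced F z)
include hz

theorem norm_X : ‖algebraMap F[X] K X‖ = q := by
  rw [hz.norm_poly X X_ne_zero, natDegree_X, pow_one]

theorem X_ne_zero : algebraMap F[X] K X ≠ 0 := by
  rw [← norm_pos_iff, hz.norm_X]
  exact zero_lt_one.trans (one_lt_card_real F)

theorem ne_zero : z ≠ 0 := norm_pos_iff.1 (zero_lt_one.trans_le hz.one_le)

theorem one_le_norm_poly {p : F[X]} (hp : p ≠ 0) : 1 ≤ ‖algebraMap F[X] K p‖ := by
  rw [hz.norm_poly p hp]
  exact one_le_pow₀ (one_lt_card_real F).le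

theorem one_le_norm_point {v : F[X] × F[X]} (hv : v ≠ 0) : 1 ≤ ‖latticePoint z v‖ := by
  rw [hz.norm_point]
  by_cases h : v.1 = 0
  · have h2 : v.2 ≠ 0 := fun h2 => hv (Prod.ext h h2)
    exact le_max_of_le_right (one_le_mul_of_one_le_of_one_le (hz.one_le_norm_poly h2) hz.one_le)
  · exact le_max_of_le_left (hz.one_le_norm_poly h)

theorem point_ne_zero {v : F[X] × F[X]} (hv : v ≠ 0) : latticePoint z v ≠ 0 :=
  norm_pos_iff.1 (zero_lt_one.trans_le (hz.one_le_norm_point hv))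

theorem point_injective : Function.Injective (latticePoint (F := F) z) := fun v w h => by
  by_contra hne
  exact hz.point_ne_zero (sub_ne_zero.2 hne) (by rw [latticePoint_sub, h, sub_self])

/-- As the box is symmetric, the zeros of `x ↦ boxExp F z n (w - x)` are the points `w + l`. The
product is therefore the quotient of this function by its value at `0`, and additivity simplifies
it. -/
theorem prod_one_sub_div_translate {n : ℕ} {w : K} (x : K)
    (hw : ∀ v ∈ box F n, w ≠ latticePoint z v)
    (hadd : boxExp F z n (w - x) = boxExp F z n w - boxExp F z n x) (hw0 : boxExp F z n w ≠ 0) :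
    ∏ v ∈ box F n, (1 - x / (w + latticePoint z v)) = 1 - boxExp F z n x / boxExp F z n w := by
  classical
  have h1 : ∏ v ∈ box F n, (1 - x / (w + latticePoint z v)) =
      boxExp F z n (w - x) / boxExp F z n w := by
    rw [← prod_box_neg, boxExp, boxExp, ← Finset.mul_prod_erase _ _ (zero_mem_box n),
      ← Finset.mul_prod_erase _ _ (zero_mem_box n), ← Finset.mul_prod_erase _ _ (zero_mem_box n)]
    have hwz : w ≠ 0 := by simpa [latticePoint_zero] using hw 0 (zero_mem_box n)
    simp only [neg_zero, latticePoint_zero, add_zero, div_zero, sub_zero, one_mul]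
    rw [mul_div_mul_comm, ← Finset.prod_div_distrib, sub_div, div_self hwz]
    congr 1
    refine Finset.prod_congr rfl fun v hv => ?_
    have hv0 := hz.point_ne_zero (Finset.ne_of_mem_erase hv)
    have hvw := sub_ne_zero.2 (hw v (Finset.mem_of_mem_erase hv))
    have hvw' : latticePoint z v - w ≠ 0 := by rwa [← neg_sub, neg_ne_zero]
    rw [latticePoint_neg, one_sub_div hv0, one_sub_div hv0, div_div_div_cancel_right₀ hv0,
      ← sub_eq_add_neg, one_sub_div hvw, ← neg_div_neg_eq]
    congr 1 <;> ring
  rw [h1, hadd, sub_div, div_self hw0]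

end IsReduced

end Lattice

/-- A ball of radius at most `1` around `1` is stable under products, since `f g - 1 = f (g - 1) +
(f - 1)`. -/
theorem norm_prod_sub_one_le {K ι : Type*} [NormedField K] [IsUltrametricDist K] {s : Finset ι}
    {f : ι → K} {ε : ℝ} (h0 : 0 ≤ ε) (h1 : ε ≤ 1) (h : ∀ i ∈ s, ‖f i - 1‖ ≤ ε) :
    ‖∏ i ∈ s, f i - 1‖ ≤ ε := by
  classical
  induction s using Finset.induction_on with
  | empty => simpa using h0
  | insert i s hi ih =>
    have h2 := ih fun j hj => h j (Finset.mem_insert_of_mem hj)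
    have h3 := h i (Finset.mem_insert_self i s)
    have h4 : ‖f i‖ ≤ 1 := by
      have : f i = (f i - 1) + 1 := by ring
      rw [this]
      refine (IsUltrametricDist.norm_add_le_max _ _).trans (max_le (h3.trans h1) ?_)
      rw [norm_one]
    rw [Finset.prod_insert hi]
    have h5 : f i * ∏ j ∈ s, f j - 1 = f i * (∏ j ∈ s, f j - 1) + (f i - 1) := by ring
    rw [h5]
    refine (IsUltrametricDist.norm_add_le_max _ _).trans (max_le ?_ h3)
    rw [norm_mul]
    exact (mul_le_mul h4 h2 (norm_nonneg _) zero_le_one).trans_eq (one_mul ε)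

theorem latticePoint_C_div {F K : Type*} [Field F] [NormedField K] [Algebra F[X] K] [Algebra F K]
    [IsScalarTower F F[X] K] (z t : K) (b : F × F) :
    latticePoint z (C b.1, C b.2) / t =
      algebraMap F K b.1 * (1 / t) + algebraMap F K b.2 * (z / t) := by
  rw [latticePoint, ← algebraMap_eq, ← IsScalarTower.algebraMap_apply,
    ← IsScalarTower.algebraMap_apply]
  ring

/-! ### The recursion for the finite exponentials -/

section Recursion

variable {F : Type*} [Field F] [Fintype F] {K : Type*} [NormedField K] [Algebra F[X] K]
  {z : K} (hz : IsReduced F z)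

local notation "q" => Fintype.card F
local notation "T" => algebraMap F[X] K X

namespace IsReduced

include hz

theorem boxExp_ne_zero {n : ℕ} {x : K} (hx : ∀ v ∈ box F n, x ≠ latticePoint z v) :
    boxExp F z n x ≠ 0 := by
  refine mul_ne_zero (by simpa [latticePoint_zero] using hx 0 (zero_mem_box n)) ?_
  rw [Finset.prod_ne_zero_iff]
  intro v hv
  rcases eq_or_ne v 0 with rfl | hv0
  · simp [latticePoint_zero]
  · have := hz.point_ne_zero hv0
    rw [one_sub_div this]
    exact div_ne_zero (sub_ne_zero.2 (hx v hv).symm) this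

/-- A nonzero pair of constants is not `T` times a lattice point: compare the polynomial coordinates
at `T = 0`. -/
theorem digit_div_ne_point {b : F × F} (hb : b ≠ 0) (v : F[X] × F[X]) :
    latticePoint z (C b.1, C b.2) / T ≠ latticePoint z v := by
  rw [Ne, div_eq_iff hz.X_ne_zero]
  intro h
  apply hb
  have h2 : latticePoint z (C b.1 + X * (-v).1, C b.2 + X * (-v).2) =
      latticePoint z (0 : F[X] × F[X]) := by
    rw [latticePoint_digit, h, latticePoint_neg, latticePoint_zero]
    ring
  obtain ⟨h3, h4⟩ := Prod.mk.inj (hz.point_injective h2)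
  ext1
  · simpa using congrArg (eval 0) h3
  · simpa using congrArg (eval 0) h4

variable [Algebra F K] [IsScalarTower F F[X] K]

/-- Each point of the next box is `T (b/T + v)` with `b` a digit and `v` in the current box. The
factors with `b = 0` give `T * boxExp F z n x`. Those with `b ≠ 0` give `1 - boxExp F z n x / boxExp
F z n (b/T)`, and by linearity these denominators run through a plane over `F`. Linearity is a
hypothesis because it is proved by induction from this recursion. -/
theorem boxExp_succ_of_linear {n : ℕ}
    (hadd : ∀ x y, boxExp F z n (x + y) = boxExp F z n x + boxExp F z n y)
    (hsmul : ∀ (c : F) x, boxExp F z n (algebraMap F K c * x) = algebraMap F K c * boxExp F z n x)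
    (x : K) :
    boxExp F z (n + 1) (T * x) =
      planePoly F T (boxExp F z n (1 / T)) (boxExp F z n (z / T)) (boxExp F z n x) := by
  classical
  have hT := hz.X_ne_zero
  have hw : ∀ b : F × F, boxExp F z n (latticePoint z (C b.1, C b.2) / T) =
      algebraMap F K b.1 * boxExp F z n (1 / T) + algebraMap F K b.2 * boxExp F z n (z / T) := by
    intro b
    rw [latticePoint_C_div, hadd, hsmul, hsmul]
  have hw0 : ∀ b : F × F, b ≠ 0 → boxExp F z n (latticePoint z (C b.1, C b.2) / T) ≠ 0 :=
    fun b hb => hz.boxExp_ne_zero fun v _ => hz.digit_div_ne_point hb v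
  have hsub : ∀ x y, boxExp F z n (x - y) = boxExp F z n x - boxExp F z n y := fun x y => by
    have h := hsmul (-1) y
    rw [map_neg, map_one, neg_one_mul, neg_one_mul] at h
    rw [sub_eq_add_neg, hadd, h, sub_eq_add_neg]
  rw [← prod_one_sub_div_plane _ _ fun b hb => hw b ▸ hw0 b hb, boxExp, prod_box_succ,
    ← Finset.mul_prod_erase _ _ (Finset.mem_univ (0 : F × F)), ← mul_assoc]
  have hfac : ∀ (b : F × F) (v : F[X] × F[X]),
      T * x / latticePoint z (C b.1 + X * v.1, C b.2 + X * v.2) =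
        x / (latticePoint z (C b.1, C b.2) / T + latticePoint z v) := by
    intro b v
    rw [latticePoint_digit, ← mul_div_mul_left x _ hT, mul_add, mul_div_cancel₀ _ hT]
  congr 1
  · rw [boxExp, mul_assoc]
    congr 2
    refine Finset.prod_congr rfl fun v _ => ?_
    rw [hfac]
    simp [latticePoint]
  · refine Finset.prod_congr rfl fun b hb => ?_
    have hb := Finset.ne_of_mem_erase hb
    rw [← hw b, ← hz.prod_one_sub_div_translate x (fun v _ => hz.digit_div_ne_point hb v)
      (hsub _ _) (hw0 b hb)]
    exact Finset.prod_congr rfl fun v _ => by rw [hfac]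

theorem boxExp_linear (n : ℕ) :
    (∀ x y, boxExp F z n (x + y) = boxExp F z n x + boxExp F z n y) ∧
    ∀ (c : F) x, boxExp F z n (algebraMap F K c * x) = algebraMap F K c * boxExp F z n x := by
  induction n with
  | zero => simp [boxExp_zero]
  | succ n ih =>
    have hT := hz.X_ne_zero
    have key := hz.boxExp_succ_of_linear ih.1 ih.2
    have hx : ∀ x : K, T * (x / T) = x := fun x => mul_div_cancel₀ x hT
    refine ⟨fun x y => ?_, fun c x => ?_⟩
    · rw [← hx x, ← hx y, ← mul_add, key, key, key, ih.1, planePoly_add]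
    · rw [← hx x, mul_left_comm, key, key, ih.2, planePoly_smul]

theorem boxExp_succ (n : ℕ) (x : K) :
    boxExp F z (n + 1) (T * x) =
      planePoly F T (boxExp F z n (1 / T)) (boxExp F z n (z / T)) (boxExp F z n x) :=
  hz.boxExp_succ_of_linear (hz.boxExp_linear n).1 (hz.boxExp_linear n).2 x

end IsReduced

end Recursion

/-! ### The absolute value of the finite exponential at `z / T` -/

section Norms

variable {F : Type*} [Field F] [Fintype F] {K : Type*} [NormedField K] [Algebra F[X] K]
  {z : K} (hz : IsReduced F z)

local notation "q" => Fintype.card F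
local notation "T" => algebraMap F[X] K X

/-- The absolute value of `boxExp F z n x` when `|x| = r` and `|x - l| = max |x| |l|`. -/
def boxNorm (F : Type*) [Field F] [Fintype F] [Algebra F[X] K] (z : K) (n : ℕ) (r : ℝ) : ℝ :=
  r * ∏ v ∈ box F n, max 1 (r / ‖latticePoint z v‖)

namespace IsReduced

include hz

theorem boxNorm_of_le_one (n : ℕ) {r : ℝ} (h1 : r ≤ 1) : boxNorm F z n r = r := by
  rw [boxNorm, Finset.prod_eq_one, mul_one]
  intro v _
  refine max_eq_left ?_
  rcases eq_or_ne v 0 with rfl | hv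
  · simp [latticePoint_zero]
  · have := hz.one_le_norm_point hv
    exact (div_le_one (by linarith)).2 (h1.trans this)

/-- No factor loses size to cancellation: `T l - z = α T + (β T - 1) z`, and `β T - 1` has the
degree of `β T` when `β ≠ 0`. Orthogonality then gives `|z/T - l| = max |z/T| |l|`. -/
theorem norm_boxExp_z_div_X (n : ℕ) :
    ‖boxExp F z n (z / T)‖ = boxNorm F z n (‖z‖ / q) := by
  have hT := hz.X_ne_zero
  rw [boxExp, boxNorm, norm_mul, norm_prod, norm_div, hz.norm_X]
  congr 1
  refine Finset.prod_congr rfl fun v _ => ?_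
  rcases eq_or_ne v 0 with rfl | hv
  · simp [latticePoint_zero]
  have hv0 := hz.point_ne_zero hv
  have hvp : 0 < ‖latticePoint z v‖ := norm_pos_iff.2 hv0
  have hq : (0 : ℝ) < q := zero_lt_one.trans (one_lt_card_real F)
  have h1 : 1 - z / T / latticePoint z v =
      latticePoint z (X * v.1, X * v.2 - 1) / (T * latticePoint z v) := by
    have : latticePoint z (X * v.1, X * v.2 - 1) = T * latticePoint z v - z := by
      simp only [latticePoint, map_sub, map_mul, map_one]
      ring
    rw [this]
    field_simp
  have h2 : ‖latticePoint z (X * v.1, X * v.2 - 1)‖ = max (q * ‖latticePoint z v‖) ‖z‖ := by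
    rw [hz.norm_point, hz.norm_point, map_mul, norm_mul, hz.norm_X, mul_max_of_nonneg _ _ hq.le,
      max_assoc]
    congr 1
    by_cases h : v.2 = 0
    · simp [h]
    · have hle := hz.one_le_norm_poly h
      have h3 : (X * v.2 - 1 : F[X]).natDegree = (X * v.2).natDegree := by
        rw [← C_1, natDegree_sub_C]
      have h4 : (X * v.2 : F[X]) ≠ 0 := mul_ne_zero Polynomial.X_ne_zero h
      have h5 : (X * v.2 - 1 : F[X]) ≠ 0 := by
        intro h0
        rw [h0, natDegree_zero, natDegree_X_mul h] at h3
        omega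
      rw [hz.norm_poly _ h5, h3, ← hz.norm_poly _ h4, map_mul, norm_mul, hz.norm_X, max_eq_left,
        mul_assoc]
      have h6 : 1 ≤ (q : ℝ) * ‖algebraMap F[X] K v.2‖ :=
        one_le_mul_of_one_le_of_one_le (one_lt_card_real F).le hle
      exact (le_mul_of_one_le_left (norm_nonneg z) h6).trans_eq (mul_assoc _ _ _)
  rw [h1, norm_div, h2, norm_mul, hz.norm_X, ← max_div_div_right (by positivity),
    div_self (by positivity), div_div]

end IsReduced

end Norms

/-! ### Convergence of the product and growth of its absolute value -/

theorem multipliable_one_sub_of_tendsto_cofinite {K ι : Type*} [NormedField K]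
    [IsUltrametricDist K] [CompleteSpace K] {f : ι → K} (hf : Tendsto f cofinite (𝓝 0)) :
    Multipliable fun i => 1 - f i := by
  classical
  have hfin : ∀ ε : ℝ, 0 < ε → ∃ s : Finset ι, ∀ i, i ∉ s → ‖f i‖ ≤ ε := by
    intro ε hε
    have h : ∀ᶠ i in cofinite, ‖f i‖ < ε := by
      simpa using hf.norm.eventually_lt_const (by simpa using hε)
    exact ⟨(eventually_cofinite.1 h).toFinset, fun i hi => by
      simpa using le_of_lt (by simpa using hi : ‖f i‖ < ε)⟩
  have hdiff : ∀ (ε : ℝ), 0 ≤ ε → ε ≤ 1 → ∀ s t : Finset ι, s ⊆ t → (∀ i, i ∉ s → ‖f i‖ ≤ ε) →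
      ‖∏ i ∈ t, (1 - f i) - ∏ i ∈ s, (1 - f i)‖ ≤ ‖∏ i ∈ s, (1 - f i)‖ * ε := by
    intro ε h0 h1 s t hst hs
    have h2 : ∏ i ∈ t, (1 - f i) - ∏ i ∈ s, (1 - f i) =
        (∏ i ∈ s, (1 - f i)) * (∏ i ∈ t \ s, (1 - f i) - 1) := by
      rw [← Finset.prod_sdiff hst]
      ring
    rw [h2, norm_mul]
    refine mul_le_mul_of_nonneg_left (norm_prod_sub_one_le h0 h1 fun i hi => ?_) (norm_nonneg _)
    rw [sub_sub_cancel_left, norm_neg]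
    exact hs i (Finset.mem_sdiff.1 hi).2
  obtain ⟨s₀, hs₀⟩ := hfin 1 one_pos
  set M := ‖∏ i ∈ s₀, (1 - f i)‖
  have hM : ∀ s, s₀ ⊆ s → ‖∏ i ∈ s, (1 - f i)‖ ≤ M := by
    intro s hs
    have h1 := hdiff 1 zero_le_one le_rfl s₀ s hs hs₀
    rw [mul_one] at h1
    rw [← sub_add_cancel (∏ i ∈ s, (1 - f i)) (∏ i ∈ s₀, (1 - f i))]
    exact (IsUltrametricDist.norm_add_le_max _ _).trans (max_le h1 le_rfl)
  have hc : CauchySeq fun s : Finset ι => ∏ i ∈ s, (1 - f i) := by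
    rw [Metric.cauchySeq_iff']
    intro ε hε
    -- Some factor may vanish, so `M` may be `0`; hence the division by `M + 1`.
    have hM1 : 0 < M + 1 := add_pos_of_nonneg_of_pos (norm_nonneg _) one_pos
    have hδ : 0 < min 1 (ε / (M + 1)) := lt_min one_pos (div_pos hε hM1)
    obtain ⟨s₁, hs₁⟩ := hfin _ hδ
    refine ⟨s₀ ∪ s₁, fun t ht => ?_⟩
    rw [dist_eq_norm]
    have h1 := hdiff _ hδ.le (min_le_left _ _) (s₀ ∪ s₁) t ht
      fun i hi => hs₁ i fun h => hi (Finset.mem_union_right _ h)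
    refine h1.trans_lt ?_
    have h2 := hM (s₀ ∪ s₁) Finset.subset_union_left
    calc _ ≤ M * (ε / (M + 1)) := mul_le_mul h2 (min_le_right _ _) hδ.le (norm_nonneg _)
      _ < (M + 1) * (ε / (M + 1)) :=
        mul_lt_mul_of_pos_right (lt_add_one M) (div_pos hε hM1)
      _ = ε := mul_div_cancel₀ ε hM1.ne'
  obtain ⟨a, ha⟩ := cauchySeq_tendsto_of_complete hc
  exact ⟨a, ha⟩

section Lattice

variable {F : Type*} [Field F] [Fintype F] {K : Type*} [NormedField K] [Algebra F[X] K]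
  [IsUltrametricDist K] {z : K} (hz : IsReduced F z)

local notation "q" => Fintype.card F
local notation "T" => algebraMap F[X] K X

namespace IsReduced

include hz

theorem norm_boxExp_sub_le (n : ℕ) {x : K} (hx : ‖x‖ ≤ 1) :
    ‖boxExp F z n x - x‖ ≤ ‖x‖ * ‖x‖ := by
  have h : boxExp F z n x - x = x * (∏ v ∈ box F n, (1 - x / latticePoint z v) - 1) := by
    rw [boxExp]
    ring
  rw [h, norm_mul]
  refine mul_le_mul_of_nonneg_left (norm_prod_sub_one_le (norm_nonneg x) hx fun v _ => ?_)
    (norm_nonneg x)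
  rw [sub_sub_cancel_left, norm_neg, norm_div]
  rcases eq_or_ne v 0 with rfl | hv
  · simp [latticePoint_zero]
  · exact div_le_self (norm_nonneg x) (hz.one_le_norm_point hv)

theorem norm_point_digit (b : F) {v : F[X] × F[X]} (hv : v ≠ 0) :
    ‖latticePoint z (C b + X * v.1, X * v.2)‖ = q * ‖latticePoint z v‖ := by
  have h1 : latticePoint z (C b + X * v.1, X * v.2) =
      algebraMap F[X] K (C b) + T * latticePoint z v := by
    simp only [latticePoint, map_add, map_mul]
    ring
  have h2 : ‖algebraMap F[X] K (C b)‖ ≤ 1 := by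
    rcases eq_or_ne b 0 with rfl | hb
    · simp
    · rw [hz.norm_poly _ (C_ne_zero.2 hb), natDegree_C, pow_zero]
  have h3 : 1 < ‖T * latticePoint z v‖ := by
    rw [norm_mul, hz.norm_X]
    exact one_lt_mul_of_lt_of_le (one_lt_card_real F) (hz.one_le_norm_point hv)
  rw [h1, IsUltrametricDist.norm_add_eq_max_of_norm_ne_norm (h2.trans_lt h3).ne,
    max_eq_right (h2.trans h3.le), norm_mul, hz.norm_X]

/-- Points whose `z`-coefficient has nonzero constant term are at least as large as `z` and
contribute `1`. Of the others, the `q - 1` nonzero constants contribute `r` each. The remaining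
nonzero ones are `b + T l` with `l ≠ 0`, of size `q |l|`, so each of the `q` digits `b` reproduces
the product for `r / q`. -/
theorem boxNorm_succ (n : ℕ) {r : ℝ} (h1 : 1 ≤ r) (h2 : r < ‖z‖) :
    boxNorm F z (n + 1) r = (q : ℝ) ^ q * boxNorm F z n (r / q) ^ q := by
  classical
  set P := ∏ v ∈ box F n, max 1 (r / q / ‖latticePoint z v‖) with hP
  set G : F × F → ℝ := fun b => ∏ v ∈ box F n,
    max 1 (r / ‖latticePoint z (C b.1 + X * v.1, C b.2 + X * v.2)‖) with hG
  have hq : (0 : ℝ) < q := zero_lt_one.trans (one_lt_card_real F)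
  have hG1 : ∀ b c, c ≠ 0 → G (b, c) = 1 := by
    intro b c hc
    refine Finset.prod_eq_one fun v _ => max_eq_left ?_
    have h0 : (C c + X * v.2 : F[X]) ≠ 0 := fun h => hc (by simpa using congrArg (eval 0) h)
    have h3 : ‖z‖ ≤ ‖latticePoint z (C b + X * v.1, C c + X * v.2)‖ := by
      rw [hz.norm_point]
      exact le_max_of_le_right
        (le_mul_of_one_le_left (norm_nonneg z) (hz.one_le_norm_poly h0))
    exact (div_le_one (by linarith)).2 (h2.le.trans h3)
  have hne : ∀ b : F, ∀ v ∈ (box F n).erase 0,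
      max 1 (r / ‖latticePoint z (C b + X * v.1, C 0 + X * v.2)‖) =
        max 1 (r / q / ‖latticePoint z v‖) := by
    intro b v hv
    rw [C_0, zero_add, hz.norm_point_digit b (Finset.ne_of_mem_erase hv), div_div]
  have hG2 : ∀ b : F, G (b, 0) = (if b = 0 then 1 else r) * P := by
    intro b
    rw [hG, hP]
    simp only
    rw [← Finset.mul_prod_erase _ _ (zero_mem_box n), Finset.prod_congr rfl (hne b),
      ← Finset.mul_prod_erase _ (fun v => max 1 (r / q / ‖latticePoint z v‖)) (zero_mem_box n),
      latticePoint_zero, norm_zero, div_zero, max_eq_left zero_le_one, one_mul]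
    congr 1
    split_ifs with hb
    · simp [latticePoint, hb]
    · have : ‖algebraMap F[X] K (C b)‖ = 1 := by
        rw [hz.norm_poly _ (C_ne_zero.2 hb), natDegree_C, pow_zero]
      simp [latticePoint, this, h1]
  have hprod : ∏ v ∈ box F (n + 1), max 1 (r / ‖latticePoint z v‖) = r ^ (q - 1) * P ^ q := by
    rw [prod_box_succ, Fintype.prod_prod_type]
    have : ∀ b : F, ∏ c : F, G (b, c) = (if b = 0 then 1 else r) * P := fun b => by
      rw [Fintype.prod_eq_single 0 fun c hc => hG1 b c hc, hG2]
    rw [Finset.prod_congr rfl fun b _ => this b, Finset.prod_mul_distrib, Finset.prod_const,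
      ← Finset.mul_prod_erase _ _ (Finset.mem_univ (0 : F)), if_pos rfl, one_mul,
      Finset.prod_congr rfl fun b hb => if_neg (Finset.ne_of_mem_erase hb), Finset.prod_const,
      Finset.card_erase_of_mem (Finset.mem_univ _), Finset.card_univ]
  rw [boxNorm, boxNorm, hprod, ← hP, ← mul_assoc, ← pow_succ', card_sub_one_add_one, ← mul_pow,
    ← mul_pow, ← mul_assoc, mul_div_cancel₀ _ hq.ne']

/-- The common value of `boxNorm F z n (q ^ m * ρ)` for `1 / q < ρ ≤ 1` and `n ≥ m`. -/
theorem boxNorm_eq_of_recursion {E : ℕ → ℝ} {ρ : ℝ} (hρ : 1 ≤ q * ρ) (hρ1 : ρ ≤ 1)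
    (hE0 : E 0 = ρ) (hE : ∀ m, E (m + 1) = (q : ℝ) ^ q * E m ^ q) {m n : ℕ} (hmn : m ≤ n)
    (hm : q ^ m * ρ < ‖z‖) : boxNorm F z n (q ^ m * ρ) = E m := by
  have hq := one_lt_card_real F
  have hρ0 : 0 < ρ := pos_of_mul_pos_right (zero_lt_one.trans_le hρ) (by linarith)
  induction m generalizing n with
  | zero => rw [pow_zero, one_mul, hz.boxNorm_of_le_one n hρ1, hE0]
  | succ m ih =>
    obtain ⟨n, rfl⟩ : ∃ k, n = k + 1 := ⟨n - 1, by omega⟩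
    have h1 : (1 : ℝ) ≤ q ^ (m + 1) * ρ := by
      rw [pow_succ, mul_assoc]
      exact one_le_mul_of_one_le_of_one_le (one_le_pow₀ hq.le) hρ
    have h2 : (q : ℝ) ^ (m + 1) * ρ / q = q ^ m * ρ := by
      rw [pow_succ]
      field_simp
    have h3 : (q : ℝ) ^ m * ρ ≤ q ^ (m + 1) * ρ :=
      mul_le_mul_of_nonneg_right (pow_le_pow_right₀ hq.le (Nat.le_succ m)) hρ0.le
    rw [hz.boxNorm_succ n h1 hm, h2, ih (by omega) (h3.trans_lt hm), hE]

omit [IsUltrametricDist K] in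
theorem exists_box_of_norm_le (r : ℝ) :
    ∃ n, ∀ v : F[X] × F[X], ‖latticePoint z v‖ ≤ r → v ∈ box F n := by
  have hq := one_lt_card_real F
  obtain ⟨n, hn⟩ := pow_unbounded_of_one_lt r hq
  have hdeg : ∀ p : F[X], ‖algebraMap F[X] K p‖ ≤ r → p.natDegree < n + 1 := by
    intro p hp
    rcases eq_or_ne p 0 with rfl | hp0
    · simp
    rw [hz.norm_poly p hp0] at hp
    have := (pow_lt_pow_iff_right₀ hq).1 (hp.trans_lt hn)
    omega
  refine ⟨n + 1, fun v hv => ?_⟩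
  rw [hz.norm_point] at hv
  exact mem_box_of_natDegree_lt (hdeg _ ((le_max_left _ _).trans hv))
    (hdeg _ ((le_mul_of_one_le_right (norm_nonneg _) hz.one_le).trans
      ((le_max_right _ _).trans hv)))

theorem tendsto_boxExp [CompleteSpace K] (x : K) :
    Tendsto (fun n => boxExp F z n x) atTop
      (𝓝 (x * ∏' v : {v : F[X] × F[X] // v ≠ 0}, (1 - x / latticePoint z v.1))) := by
  classical
  have hf : Tendsto (fun v : {v : F[X] × F[X] // v ≠ 0} => x / latticePoint z v.1) cofinite
      (𝓝 0) := by
    rw [tendsto_zero_iff_norm_tendsto_zero, Metric.tendsto_nhds]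
    intro ε hε
    obtain ⟨n, hn⟩ := hz.exists_box_of_norm_le (‖x‖ / ε)
    rw [eventually_cofinite]
    refine ((box F n).finite_toSet.preimage Subtype.val_injective.injOn).subset fun v hv => ?_
    refine hn v.1 ?_
    have hpos : 0 < ‖latticePoint z v.1‖ := norm_pos_iff.2 (hz.point_ne_zero v.2)
    have hv : ε ≤ ‖x‖ / ‖latticePoint z v.1‖ := by simpa using hv
    rw [le_div_iff₀ hε, mul_comm]
    exact (le_div_iff₀ hpos).1 hv
  have hs : Tendsto (fun n => (box F n).subtype (· ≠ 0)) atTop atTop := by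
    refine tendsto_atTop_finset_of_monotone (fun m n hmn => ?_) fun v => ?_
    · exact Finset.subtype_mono (box_mono hmn)
    · obtain ⟨n, hn⟩ := hz.exists_box_of_norm_le ‖latticePoint z v.1‖
      exact ⟨n, Finset.mem_subtype.2 (hn _ le_rfl)⟩
  have h := (multipliable_one_sub_of_tendsto_cofinite hf).hasProd.comp hs
  refine (h.const_mul x).congr fun n => ?_
  rw [Function.comp_apply, boxExp]
  congr 1
  rw [Finset.prod_subtype_eq_prod_filter (fun v => 1 - x / latticePoint z v), Finset.prod_filter]
  refine Finset.prod_congr rfl fun v _ => ?_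
  split_ifs with hv
  · rfl
  · simp [not_not.1 hv, latticePoint_zero]

end IsReduced

end Lattice

/-! ### Twisted polynomials and rank two Drinfeld modules -/

section Twisted

variable {F : Type u} [Field F] [Fintype F]

local notation "q" => Fintype.card F

instance scalarTowerCInfty : IsScalarTower F F[X] (CInfty F) :=
  IsScalarTower.of_algebraMap_eq fun _ => rfl

theorem iterate_phi_eq_pow (n : ℕ) (x : CInfty F) :
    SkewPolynomial.φ^[n] x = x ^ q ^ n :=
  SkewPolynomial.φ_iterate_apply n x

theorem add_pow_card_pow (n : ℕ) (x y : CInfty F) : (x + y) ^ q ^ n = x ^ q ^ n + y ^ q ^ n :=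
  smul_add (Multiplicative.ofAdd n) x y

namespace Twisted

theorem eval_zero (x : CInfty F) : Twisted.eval (0 : Twisted F) x = 0 := rfl

theorem eval_add (p r : Twisted F) (x : CInfty F) : (p + r).eval x = p.eval x + r.eval x :=
  SkewMonoidAlgebra.sum_add_index' (fun _ => zero_mul _) fun _ _ _ => add_mul _ _ _

theorem eval_monomial (n : ℕ) (c x : CInfty F) :
    Twisted.eval (SkewPolynomial.monomial n c) x = c * x ^ q ^ n :=
  SkewPolynomial.sum_monomial_index (zero_mul _)

theorem eval_add_right (p : Twisted F) (x y : CInfty F) : p.eval (x + y) = p.eval x + p.eval y := by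
  induction p using SkewPolynomial.induction with
  | h0 => simp [eval_zero]
  | ha n c p _ _ ih =>
    rw [eval_add, eval_add, eval_add, ih, eval_monomial, eval_monomial, eval_monomial,
      add_pow_card_pow]
    ring

theorem eval_mul (p r : Twisted F) (x : CInfty F) : (p * r).eval x = p.eval (r.eval x) := by
  induction p using SkewPolynomial.induction with
  | h0 => rw [zero_mul, eval_zero, eval_zero]
  | ha n c p _ _ ih =>
    rw [add_mul, eval_add, eval_add, ih]
    congr 1
    clear ih
    induction r using SkewPolynomial.induction with
    | h0 => rw [mul_zero, eval_zero, eval_monomial, zero_pow (pow_ne_zero _ Fintype.card_ne_zero),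
        mul_zero]
    | ha m d r _ _ ihr =>
      rw [mul_add, eval_add, eval_add, ihr, SkewPolynomial.monomial_mul_monomial,
        iterate_phi_eq_pow, eval_add_right]
      · congr 1
        rw [eval_monomial, eval_monomial, eval_monomial, mul_pow, pow_add, ← pow_mul,
          mul_comm (q ^ m), mul_assoc]

theorem coeff_monomial_mul (k : ℕ) (c : CInfty F) (p : Twisted F) (n : ℕ) :
    SkewPolynomial.coeff (SkewPolynomial.monomial k c * p) n =
      if k ≤ n then c * SkewPolynomial.coeff p (n - k) ^ q ^ k else 0 := by
  induction p using SkewPolynomial.induction with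
  | h0 => simp
  | ha m d p _ _ ih =>
    rw [mul_add, SkewPolynomial.coeff_add, SkewPolynomial.coeff_add, ih, SkewPolynomial.monomial_mul_monomial,
      iterate_phi_eq_pow, SkewPolynomial.coeff_monomial, SkewPolynomial.coeff_monomial]
    split_ifs with h1 h2 h3 h4 h5
    · rw [add_pow_card_pow, mul_add]
    · omega
    · omega
    · omega
    · rw [zero_add, zero_add]
    · rw [add_zero]

/-- The exponents `q ^ n` are distinct, so the coefficients survive in the associated ordinary
polynomial, which has infinitely many roots. -/
theorem eq_zero_of_infinite {p : Twisted F} {S : Set (CInfty F)} (hS : S.Infinite)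
    (h : ∀ x ∈ S, p.eval x = 0) : p = 0 := by
  have hq : Function.Injective fun n : ℕ => q ^ n :=
    Nat.pow_right_injective (Fintype.one_lt_card (α := F))
  set P : (CInfty F)[X] :=
    ∑ n ∈ SkewPolynomial.support p, monomial (q ^ n) (SkewPolynomial.coeff p n) with hP
  have hPe : ∀ x, P.eval x = Twisted.eval p x := by
    intro x
    rw [hP, eval_finsetSum, Twisted.eval, SkewPolynomial.sum_def]
    simp [Polynomial.eval_monomial]
  have hP0 : P = 0 := Polynomial.eq_zero_of_infinite_isRoot P
    (hS.mono fun x hx => by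
      change P.eval x = 0
      rw [hPe, h x hx])
  rw [← SkewPolynomial.support_eq_empty, Finset.eq_empty_iff_forall_notMem]
  intro n hn
  apply SkewPolynomial.mem_support_iff.1 hn
  have h1 : P.coeff (q ^ n) = SkewPolynomial.coeff p n := by
    rw [hP, finsetSum_coeff, Finset.sum_eq_single n]
    · simp
    · intro m _ hm
      rw [coeff_monomial, if_neg (hq.ne hm)]
    · exact fun h => absurd hn h
  rw [← h1, hP0, Polynomial.coeff_zero]

end Twisted

/-- The twisted polynomial `T + g τ + Δ τ²`. -/
def rankTwoTwisted (g Δ : CInfty F) : Twisted F :=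
  SkewPolynomial.C (algebraMap F[X] (CInfty F) X) + SkewPolynomial.monomial 1 g +
    SkewPolynomial.monomial 2 Δ

theorem eval_rankTwoTwisted (g Δ x : CInfty F) :
    (rankTwoTwisted g Δ).eval x =
      algebraMap F[X] (CInfty F) X * x + g * x ^ q + Δ * x ^ q ^ 2 := by
  rw [rankTwoTwisted, ← SkewPolynomial.monomial_zero_left, Twisted.eval_add, Twisted.eval_add,
    Twisted.eval_monomial, Twisted.eval_monomial, Twisted.eval_monomial, pow_zero, pow_one, pow_one]

theorem coeff_rankTwoTwisted_mul (g Δ : CInfty F) (p : Twisted F) (n : ℕ) :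
    SkewPolynomial.coeff (rankTwoTwisted g Δ * p) n =
      algebraMap F[X] (CInfty F) X * SkewPolynomial.coeff p n +
      (if 1 ≤ n then g * SkewPolynomial.coeff p (n - 1) ^ q else 0) +
      if 2 ≤ n then Δ * SkewPolynomial.coeff p (n - 2) ^ q ^ 2 else 0 := by
  rw [rankTwoTwisted, ← SkewPolynomial.monomial_zero_left, add_mul, add_mul, SkewPolynomial.coeff_add,
    SkewPolynomial.coeff_add, Twisted.coeff_monomial_mul, Twisted.coeff_monomial_mul,
    Twisted.coeff_monomial_mul, if_pos (Nat.zero_le n), Nat.sub_zero, pow_zero, pow_one, pow_one]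

/-- The ring homomorphism `F[T] → 𝐂{τ}` with `T ↦ T + g τ + Δ τ²`. -/
def rankTwoHom (g Δ : CInfty F) : F[X] →+* Twisted F :=
  eval₂RingHom' (SkewPolynomial.CRingHom.comp (algebraMap F (CInfty F))) (rankTwoTwisted g Δ) (by
    intro c
    change SkewPolynomial.C (algebraMap F (CInfty F) c) * _ =
      _ * SkewPolynomial.C (algebraMap F (CInfty F) c)
    -- Elements of `F` are fixed by Frobenius, so they commute with `τ`.
    rw [rankTwoTwisted, mul_add, mul_add, add_mul, add_mul, ← SkewPolynomial.C_mul,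
      ← SkewPolynomial.C_mul, SkewPolynomial.C_mul_monomial, SkewPolynomial.C_mul_monomial,
      SkewPolynomial.monomial_mul_C, SkewPolynomial.monomial_mul_C, iterate_phi_eq_pow,
      iterate_phi_eq_pow, pow_two, pow_mul, pow_one, algebraMap_pow_card, algebraMap_pow_card,
      mul_comm _ g, mul_comm _ Δ, mul_comm (algebraMap F[X] (CInfty F) X)])

theorem rankTwoHom_C (g Δ : CInfty F) (c : F) :
    rankTwoHom g Δ (C c) = SkewPolynomial.C (algebraMap F (CInfty F) c) :=
  eval₂_C _ _

theorem rankTwoHom_X (g Δ : CInfty F) : rankTwoHom g Δ X = rankTwoTwisted g Δ :=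
  eval₂_X _ _

/-- Induction on the degree through `a = T a' + a(0)`: multiplication by `φ_T` sends a top
coefficient `c` to `Δ c^(q²)`, two degrees higher. -/
theorem coeff_rankTwoHom (g Δ : CInfty F) (hΔ : Δ ≠ 0) (a : F[X]) :
    SkewPolynomial.coeff (rankTwoHom g Δ a) 0 = algebraMap F[X] (CInfty F) a ∧
    (a ≠ 0 → SkewPolynomial.coeff (rankTwoHom g Δ a) (2 * a.natDegree) ≠ 0) ∧
    ∀ n, 2 * a.natDegree < n → SkewPolynomial.coeff (rankTwoHom g Δ a) n = 0 := by
  have hq : q ≠ 0 := Fintype.card_ne_zero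
  induction hn : a.natDegree generalizing a with
  | zero =>
    rw [eq_C_of_natDegree_eq_zero hn, rankTwoHom_C]
    refine ⟨SkewPolynomial.coeff_C_zero.trans rfl, fun h => ?_, fun n h => ?_⟩
    · rw [mul_zero, SkewPolynomial.coeff_C_zero, Ne, map_eq_zero]
      simpa using h
    · exact SkewPolynomial.coeff_C_ne_zero (by omega)
  | succ d ih =>
    have hd : a.divX.natDegree = d := by
      rw [natDegree_divX_eq_natDegree_tsub_one, hn, Nat.add_sub_cancel]
    obtain ⟨h0, h1, h2⟩ := ih a.divX hd
    have ha : rankTwoHom g Δ a = rankTwoTwisted g Δ * rankTwoHom g Δ a.divX +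
        SkewPolynomial.C (algebraMap F (CInfty F) (a.coeff 0)) := by
      conv_lhs => rw [← X_mul_divX_add a, map_add, map_mul, rankTwoHom_X, rankTwoHom_C]
    have hdiv : a.divX ≠ 0 := by
      intro h
      rw [divX_eq_zero_iff] at h
      rw [h, natDegree_C] at hn
      omega
    refine ⟨?_, fun _ => ?_, fun n h => ?_⟩
    · rw [ha, SkewPolynomial.coeff_add, coeff_rankTwoTwisted_mul, h0, SkewPolynomial.coeff_C_zero,
        if_neg (by omega), if_neg (by omega), add_zero, add_zero]
      conv_rhs => rw [← X_mul_divX_add a, map_add, map_mul]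
      rfl
    · rw [ha, SkewPolynomial.coeff_add, coeff_rankTwoTwisted_mul, SkewPolynomial.coeff_C_ne_zero (by omega),
        h2 _ (by omega), h2 _ (by omega), if_pos (by omega), if_pos (by omega), zero_pow hq,
        mul_zero, mul_zero, zero_add, zero_add, add_zero]
      exact mul_ne_zero hΔ (pow_ne_zero _ (h1 hdiv))
    · rw [ha, SkewPolynomial.coeff_add, coeff_rankTwoTwisted_mul, SkewPolynomial.coeff_C_ne_zero (by omega),
        h2 _ (by omega), h2 _ (by omega), h2 _ (by omega), zero_pow hq,
        zero_pow (pow_ne_zero 2 hq)]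
      simp

/-- The Drinfeld module of rank two with `φ_T = T + g τ + Δ τ²`. -/
def rankTwoModule (g Δ : CInfty F) (hΔ : Δ ≠ 0) : DrinfeldModule F 2 where
  toRingHom := rankTwoHom g Δ
  coeff_zero a := (coeff_rankTwoHom g Δ hΔ a).1
  coeff_top a := (coeff_rankTwoHom g Δ hΔ a).2.1
  coeff_above a := (coeff_rankTwoHom g Δ hΔ a).2.2

theorem j_rankTwoModule (g Δ : CInfty F) (hΔ : Δ ≠ 0) :
    (rankTwoModule g Δ hΔ).j = g ^ (q + 1) / Δ := by
  have h : ∀ n, SkewPolynomial.coeff ((rankTwoModule g Δ hΔ).toRingHom X) n =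
      SkewPolynomial.coeff (rankTwoTwisted g Δ) n := fun n =>
    congrArg (fun p => SkewPolynomial.coeff p n) (rankTwoHom_X g Δ)
  rw [DrinfeldModule.j, h, h, rankTwoTwisted]
  simp [SkewPolynomial.coeff_monomial]

theorem rankTwoModule_isAssociated (g Δ : CInfty F) (hΔ : Δ ≠ 0)
    (Λ : Submodule F[X] (CInfty F))
    (hadd : ∀ x y, latticeExp Λ (x + y) = latticeExp Λ x + latticeExp Λ y)
    (hsmul : ∀ (c : F) x, latticeExp Λ (algebraMap F (CInfty F) c * x) =
      algebraMap F (CInfty F) c * latticeExp Λ x)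
    (hX : ∀ x, latticeExp Λ (algebraMap F[X] (CInfty F) X * x) =
      algebraMap F[X] (CInfty F) X * latticeExp Λ x + g * latticeExp Λ x ^ q +
        Δ * latticeExp Λ x ^ q ^ 2) :
    (rankTwoModule g Δ hΔ).IsAssociated Λ := by
  intro a
  change ∀ x, _ = (rankTwoHom g Δ a).eval _
  have hC : ∀ (c : F) (x : CInfty F), latticeExp Λ (algebraMap F[X] (CInfty F) (C c) * x) =
      (rankTwoHom g Δ (C c)).eval (latticeExp Λ x) := by
    intro c x
    rw [rankTwoHom_C, ← SkewPolynomial.monomial_zero_left, Twisted.eval_monomial, pow_zero, pow_one,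
      ← hsmul]
    rfl
  induction a using Polynomial.induction_on with
  | C c => exact hC c
  | add a b iha ihb =>
    intro x
    rw [map_add, map_add, add_mul, hadd, iha, ihb, Twisted.eval_add]
  | monomial n c ih =>
    intro x
    rw [pow_succ, ← mul_assoc, map_mul _ (C c * X ^ n), map_mul _ (C c * X ^ n), Twisted.eval_mul,
      mul_assoc, ih, hX, rankTwoHom_X, eval_rankTwoTwisted]

theorem DrinfeldModule.IsAssociated.eq {r : ℕ} {φ ψ : DrinfeldModule F r}
    {Λ : Submodule F[X] (CInfty F)} (hφ : φ.IsAssociated Λ) (hψ : ψ.IsAssociated Λ)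
    (hinf : (Set.range (latticeExp Λ)).Infinite) : φ = ψ := by
  ext1
  refine RingHom.ext fun a => sub_eq_zero.1 (Twisted.eq_zero_of_infinite hinf ?_)
  rintro _ ⟨x, rfl⟩
  have h1 := Twisted.eval_add (φ.toRingHom a - ψ.toRingHom a) (ψ.toRingHom a) (latticeExp Λ x)
  rw [sub_add_cancel, ← hφ, ← hψ] at h1
  exact add_eq_right.1 h1.symm

end Twisted

/-! ### Orthogonality in the quadratic fundamental domain -/

section Reduced

variable {F : Type u} [Field F] [Fintype F]

local notation "q" => Fintype.card F
local notation "ι" => algebraMap F[X] (CInfty F)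

variable (F) in
/-- `k_∞`, as a subfield of `𝐂`. -/
def kInftySubfield : Subfield (CInfty F) := (algebraMap (KInfty F) (CInfty F)).fieldRange

/-- In characteristic dividing `q`, `t^(q^n) → 1`. Since `q` is odd, `t^(q^n - 1)` is a power of
`t²`; it tends to `1 / t`, and `k_∞` is closed. -/
theorem mem_kInfty_of_sq_mem (hq : Odd q) {t : CInfty F} (ht : ‖t - 1‖ < 1) (h : t ^ 2 ∈ kInftySubfield F) :
    t ∈ kInftySubfield F := by
  have ht0 : t ≠ 0 := by
    rintro rfl
    simp at ht
  have hlim : Tendsto (fun n : ℕ => t ^ q ^ n) atTop (𝓝 1) := by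
    have h1 : ∀ n : ℕ, t ^ q ^ n = (t - 1) ^ q ^ n + 1 := fun n => by
      have := add_pow_card_pow n (t - 1) 1
      rwa [sub_add_cancel, one_pow] at this
    have h2 : Tendsto (fun n : ℕ => (t - 1) ^ q ^ n) atTop (𝓝 0) :=
      (tendsto_pow_atTop_nhds_zero_of_norm_lt_one ht).comp
        (tendsto_pow_atTop_atTop_of_one_lt (Fintype.one_lt_card (α := F)))
    simpa only [h1, zero_add] using h2.add_const 1
  have hlim2 : Tendsto (fun n : ℕ => (t ^ 2) ^ (q ^ n / 2)) atTop (𝓝 (1 / t)) := by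
    refine (hlim.div_const t).congr fun n => ?_
    rw [div_eq_iff ht0, ← pow_mul, ← pow_succ]
    congr 1
    have := (hq.pow (n := n))
    exact (Nat.two_mul_div_two_add_one_of_odd this).symm
  have hmem : 1 / t ∈ kInftySubfield F := isClosed_range_kInfty.mem_of_tendsto hlim2
    (Eventually.of_forall fun n => (pow_mem h _ : (t ^ 2) ^ (q ^ n / 2) ∈ kInftySubfield F))
  have := inv_mem hmem
  rwa [one_div, inv_inv] at this

theorem algebraMap_polynomial_mem (p : F[X]) : ι p ∈ kInftySubfield F := ⟨_, rfl⟩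

theorem norm_two (hq : Odd q) : ‖(2 : CInfty F)‖ = 1 := by
  have h2 : (2 : F) ≠ 0 := by
    refine Ring.two_ne_zero fun h => ?_
    rw [FiniteField.even_card_iff_char_two, ← Nat.even_iff] at h
    exact Nat.not_even_iff_odd.2 hq h
  have h : ι (C (2 : F)) = 2 := by
    rw [show C (2 : F) = (2 : F[X]) from map_ofNat C 2, map_ofNat]
  rw [← h, norm_algebraMap_polynomial (C_ne_zero.2 h2), natDegree_C, pow_zero]

section Equation

variable {a b c : F[X]} {z : CInfty F} (habc : IsReducedEquation a b c z)
include habc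

theorem IsReducedEquation.one_le_norm : 1 ≤ ‖z‖ := by
  by_contra! h
  have hc : ι c = -(ι a * z ^ 2 + ι b * z) := by linear_combination habc.equation
  refine habc.norm_le.not_gt ?_
  have ha : 0 < ‖ι a‖ := (norm_nonneg _).trans_lt habc.norm_lt
  rw [hc, norm_neg]
  refine (IsUltrametricDist.norm_add_le_max _ _).trans_lt (max_lt ?_ ?_)
  · rw [norm_mul, norm_pow]
    exact mul_lt_of_lt_one_right ha (pow_lt_one₀ (norm_nonneg z) h two_ne_zero)
  · rw [norm_mul]
    exact (mul_le_of_le_one_right (norm_nonneg _) h.le).trans_lt habc.norm_lt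

theorem IsReducedEquation.norm_sqrt_discr (hq : Odd q) : ‖2 * ι a * z + ι b‖ = ‖ι a‖ * ‖z‖ := by
  have h1 : ‖2 * ι a * z‖ = ‖ι a‖ * ‖z‖ := by rw [norm_mul, norm_mul, norm_two hq, one_mul]
  have h2 : ‖ι b‖ < ‖2 * ι a * z‖ := by
    rw [h1]
    exact habc.norm_lt.trans_le (le_mul_of_one_le_right (norm_nonneg _) habc.one_le_norm)
  rw [IsUltrametricDist.norm_add_eq_max_of_norm_ne_norm h2.ne', max_eq_left h2.le, h1]

theorem IsReducedEquation.sqrt_discr_sq :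
    (2 * ι a * z + ι b) ^ 2 = ι (b ^ 2 - 4 * a * c) := by
  simp only [map_sub, map_mul, map_pow, map_ofNat]
  linear_combination 4 * ι a * habc.equation

/-- A closer `y` would make the ratio of `r = 2az + b` to `s = 2ay + b` a one-unit. Its square `d /
s²` lies in `k_∞`, hence so do the ratio and `z`. -/
theorem IsReducedEquation.norm_le_norm_sub (hq : Odd q) (hz : z ∉ kInftySubfield F) {y : CInfty F}
    (hy : y ∈ kInftySubfield F) : ‖z‖ ≤ ‖z - y‖ := by
  by_contra! h
  have ha : 0 < ‖ι a‖ := (norm_nonneg _).trans_lt habc.norm_lt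
  have ha0 : ι a ≠ 0 := norm_pos_iff.1 ha
  have h20 : (2 : CInfty F) ≠ 0 := norm_pos_iff.1 (by rw [norm_two hq]; exact one_pos)
  set r := 2 * ι a * z + ι b with hr
  set s := 2 * ι a * y + ι b with hs
  have hsk : s ∈ kInftySubfield F := add_mem (mul_mem (mul_mem (ofNat_mem _ 2)
    (algebraMap_polynomial_mem a)) hy) (algebraMap_polynomial_mem b)
  have hrs : ‖r - s‖ < ‖r‖ := by
    have : r - s = 2 * ι a * (z - y) := by rw [hr, hs]; ring
    rw [this, hr, habc.norm_sqrt_discr hq, norm_mul, norm_mul, norm_two hq, one_mul]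
    exact mul_lt_mul_of_pos_left h ha
  have hsr : ‖s‖ = ‖r‖ := by
    have : s = r + -(r - s) := by ring
    rw [this, IsUltrametricDist.norm_add_eq_max_of_norm_ne_norm (by rw [norm_neg]; exact hrs.ne'),
      norm_neg, max_eq_left hrs.le]
  have hspos : 0 < ‖s‖ := hsr ▸ (norm_nonneg _).trans_lt hrs
  have hs0 : s ≠ 0 := norm_pos_iff.1 hspos
  have ht : r / s ∈ kInftySubfield F := by
    refine mem_kInfty_of_sq_mem hq ?_ ?_
    · rw [div_sub_one hs0, norm_div, div_lt_one hspos, hsr]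
      exact hrs
    · rw [div_pow, hr, habc.sqrt_discr_sq]
      exact div_mem (algebraMap_polynomial_mem _) (pow_mem hsk 2)
  apply hz
  have hzr : z = (r / s * s - ι b) / (2 * ι a) := by
    rw [div_mul_cancel₀ r hs0, hr]
    field_simp
    ring
  rw [hzr]
  exact div_mem (sub_mem (mul_mem ht hsk) (algebraMap_polynomial_mem b))
    (mul_mem (ofNat_mem _ 2) (algebraMap_polynomial_mem a))

theorem IsReducedEquation.isReduced (hq : Odd q) (hz : z ∉ kInftySubfield F) : IsReduced F z where
  norm_poly _ hp := norm_algebraMap_polynomial hp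
  one_le := habc.one_le_norm
  norm_point v := by
    by_cases h : ‖ι v.1‖ = ‖ι v.2 * z‖
    · rcases eq_or_ne (ι v.2) 0 with h0 | h0
      · simp [latticePoint, h0]
      · rw [← norm_mul, h, max_self]
        refine le_antisymm ((IsUltrametricDist.norm_add_le_max _ _).trans (by rw [h, max_self])) ?_
        -- Only equal norms allow cancellation; then `-α / β` is an element of `k_∞` to compare with
        -- `z`.
        have h1 : latticePoint z v = ι v.2 * (z - -(ι v.1 / ι v.2)) := by
          rw [latticePoint]
          field_simp
          ring
        rw [h1, norm_mul, norm_mul]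
        exact mul_le_mul_of_nonneg_left (habc.norm_le_norm_sub hq hz (neg_mem
          (div_mem (algebraMap_polynomial_mem _) (algebraMap_polynomial_mem _)))) (norm_nonneg _)
    · rw [latticePoint, IsUltrametricDist.norm_add_eq_max_of_norm_ne_norm h, norm_mul]

end Equation

end Reduced

theorem one_div_card_lt_one (F : Type*) [Field F] [Fintype F] : 1 / (Fintype.card F : ℝ) < 1 := by
  have := one_lt_card_real F
  exact (div_lt_one (by linarith)).2 this

/-! ### The exponential of the lattice and its Drinfeld module -/

section LatticeExp

variable {F : Type u} [Field F] [Fintype F] {z : CInfty F} (hz : IsReduced F z)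

local notation "q" => Fintype.card F
local notation "T" => algebraMap F[X] (CInfty F) X
local notation "e" => latticeExp (latticeOf z)

namespace IsReduced

include hz

theorem tendsto_latticeExp (x : CInfty F) :
    Tendsto (fun n => boxExp F z n x) atTop (𝓝 (e x)) := by
  have hmem : ∀ v : F[X] × F[X], latticePoint z v ∈ latticeOf z := fun v =>
    Submodule.mem_span_pair.2 ⟨v.1, v.2, by
      rw [Algebra.smul_def, Algebra.smul_def, mul_one, latticePoint]⟩
  let E : {v : F[X] × F[X] // v ≠ 0} ≃ {l : CInfty F // l ∈ latticeOf z ∧ l ≠ 0} :=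
    Equiv.ofBijective (fun v => ⟨latticePoint z v.1, hmem v.1, hz.point_ne_zero v.2⟩)
      ⟨fun v w h => Subtype.ext (hz.point_injective (congrArg Subtype.val h)), by
        rintro ⟨l, hl, hl0⟩
        obtain ⟨α, β, h⟩ := Submodule.mem_span_pair.1 hl
        rw [Algebra.smul_def, Algebra.smul_def, mul_one] at h
        refine ⟨⟨(α, β), ?_⟩, Subtype.ext h⟩
        rintro h0
        obtain ⟨rfl, rfl⟩ := Prod.mk.inj h0
        exact hl0 (by simpa using h.symm)⟩
  have h := hz.tendsto_boxExp x
  rw [latticeExp, ← E.tprod_eq]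
  exact h

theorem latticeExp_add (x y : CInfty F) : e (x + y) = e x + e y :=
  tendsto_nhds_unique (hz.tendsto_latticeExp _)
    (((hz.tendsto_latticeExp x).add (hz.tendsto_latticeExp y)).congr
      fun n => ((hz.boxExp_linear n).1 x y).symm)

theorem latticeExp_smul (c : F) (x : CInfty F) :
    e (algebraMap F (CInfty F) c * x) = algebraMap F (CInfty F) c * e x :=
  tendsto_nhds_unique (hz.tendsto_latticeExp _)
    (((hz.tendsto_latticeExp x).const_mul _).congr fun n => ((hz.boxExp_linear n).2 c x).symm)

/-- This is the limit of the finite recursion. The two nonvanishing hypotheses keep the denominator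
of `planeDelta` away from `0` in the limit. -/
theorem latticeExp_X_mul (h₁ : e (1 / T) ≠ 0) (h₂ : linePoly F (e (1 / T)) (e (z / T)) ≠ 0)
    (x : CInfty F) : e (T * x) = planePoly F T (e (1 / T)) (e (z / T)) (e x) := by
  refine tendsto_nhds_unique ((tendsto_add_atTop_iff_nat 1).2 (hz.tendsto_latticeExp (T * x))) ?_
  refine Tendsto.congr (fun n => (hz.boxExp_succ n x).symm) ?_
  have t₁ := hz.tendsto_latticeExp (1 / T)
  have t₂ := hz.tendsto_latticeExp (z / T)
  have t := hz.tendsto_latticeExp x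
  have tD : Tendsto (fun n => linePoly F (boxExp F z n (1 / T)) (boxExp F z n (z / T))) atTop
      (𝓝 (linePoly F (e (1 / T)) (e (z / T)))) :=
    (t₂.pow q).sub ((t₁.pow (q - 1)).mul t₂)
  have tΔ : Tendsto (fun n => planeDelta F T (boxExp F z n (1 / T)) (boxExp F z n (z / T))) atTop
      (𝓝 (planeDelta F T (e (1 / T)) (e (z / T)))) :=
    tendsto_const_nhds.div ((t₁.pow _).mul (tD.pow _))
      (mul_ne_zero (pow_ne_zero _ h₁) (pow_ne_zero _ h₂))
  exact ((t.const_mul T).add (((((t₁.pow _).pow _).add (tD.pow _)).neg.mul tΔ).mul (t.pow _))).add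
    (tΔ.mul (t.pow _))

theorem norm_latticeExp_sub_le {x : CInfty F} (hx : ‖x‖ ≤ 1) : ‖e x - x‖ ≤ ‖x‖ * ‖x‖ :=
  le_of_tendsto ((hz.tendsto_latticeExp x).sub_const x).norm
    (Eventually.of_forall fun n => hz.norm_boxExp_sub_le n hx)

theorem norm_latticeExp_of_lt_one {x : CInfty F} (hx : ‖x‖ < 1) : ‖e x‖ = ‖x‖ := by
  rcases eq_or_ne x 0 with rfl | hx0
  · simp [latticeExp]
  have h1 : ‖e x - x‖ < ‖x‖ := (hz.norm_latticeExp_sub_le hx.le).trans_lt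
    (mul_lt_of_lt_one_left (norm_pos_iff.2 hx0) hx)
  rw [← sub_add_cancel (e x) x, IsUltrametricDist.norm_add_eq_max_of_norm_ne_norm h1.ne,
    max_eq_right h1.le]

theorem norm_one_div_X : ‖1 / T‖ = 1 / (q : ℝ) := by
  rw [norm_div, norm_one, hz.norm_X]

theorem norm_latticeExp_one_div_X : ‖e (1 / T)‖ = 1 / (q : ℝ) := by
  rw [hz.norm_latticeExp_of_lt_one (by rw [hz.norm_one_div_X]; exact one_div_card_lt_one F),
    hz.norm_one_div_X]

theorem infinite_range_latticeExp : (Set.range e).Infinite := by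
  have h1 := hz.norm_one_div_X
  have hlt := one_div_card_lt_one F
  have hpos : 0 < 1 / (q : ℝ) := one_div_pos.2 (zero_lt_one.trans (one_lt_card_real F))
  refine Set.infinite_of_injective_forall_mem (f := fun n : ℕ => e ((1 / T) ^ (n + 1))) ?_
    fun n => ⟨_, rfl⟩
  intro m n hmn
  have h2 : ∀ n : ℕ, ‖e ((1 / T) ^ (n + 1))‖ = (1 / (q : ℝ)) ^ (n + 1) := fun n => by
    have h3 : ‖(1 / T) ^ (n + 1)‖ = (1 / (q : ℝ)) ^ (n + 1) := by rw [norm_pow, h1]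
    rw [hz.norm_latticeExp_of_lt_one (by
      rw [h3]; exact pow_lt_one₀ hpos.le hlt n.succ_ne_zero), h3]
  have h4 := congrArg norm hmn
  simp only [h2] at h4
  have := pow_right_injective₀ hpos hlt.ne h4
  omega

theorem norm_latticeExp_z_div_X {E : ℝ} {m : ℕ} (h : ∀ n, m ≤ n → boxNorm F z n (‖z‖ / q) = E) :
    ‖e (z / T)‖ = E := by
  refine tendsto_nhds_unique (hz.tendsto_latticeExp (z / T)).norm ?_
  refine tendsto_const_nhds.congr' ?_
  filter_upwards [eventually_ge_atTop m] with n hn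
  rw [hz.norm_boxExp_z_div_X, h n hn]

/-- Once `linePoly F (e (1 / T)) (e (z / T)) ≠ 0`, the lattice `A + A z` has exactly one associated
Drinfeld module, and its `j`-invariant is known in terms of `e (1 / T)` and `e (z / T)`. -/
theorem existsUnique_isAssociated (h₂ : linePoly F (e (1 / T)) (e (z / T)) ≠ 0) :
    (∃! φ : DrinfeldModule F 2, φ.IsAssociated (latticeOf z)) ∧
      ∀ φ : DrinfeldModule F 2, φ.IsAssociated (latticeOf z) →
        ‖φ.j‖ = ‖(e (1 / T) ^ (q - 1)) ^ q + linePoly F (e (1 / T)) (e (z / T)) ^ (q - 1)‖ ^ (q + 1) *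
          ‖planeDelta F T (e (1 / T)) (e (z / T))‖ ^ q := by
  have h₁ : e (1 / T) ≠ 0 := norm_pos_iff.1 (by
    rw [hz.norm_latticeExp_one_div_X]
    exact one_div_pos.2 (zero_lt_one.trans (one_lt_card_real F)))
  have hΔ : planeDelta F T (e (1 / T)) (e (z / T)) ≠ 0 :=
    div_ne_zero hz.X_ne_zero (mul_ne_zero (pow_ne_zero _ h₁) (pow_ne_zero _ h₂))
  have hass := rankTwoModule_isAssociated (planeG F T (e (1 / T)) (e (z / T))) _ hΔ (latticeOf z)
    hz.latticeExp_add hz.latticeExp_smul (hz.latticeExp_X_mul h₁ h₂)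
  refine ⟨⟨_, hass, fun φ hφ => hφ.eq hass hz.infinite_range_latticeExp⟩, fun φ hφ => ?_⟩
  -- Since `g = -N Δ`, one factor `Δ` cancels in `g^(q+1) / Δ`.
  rw [hφ.eq hass hz.infinite_range_latticeExp, j_rankTwoModule, norm_div, norm_pow, planeG,
    norm_mul, norm_neg, mul_pow, pow_succ ‖planeDelta F T (e (1 / T)) (e (z / T))‖, ← mul_assoc,
    mul_div_cancel_right₀ _ (norm_ne_zero_iff.2 hΔ)]

end IsReduced

end LatticeExp

/-- `x` and `y` are integral and congruent modulo `δ`. -/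
structure Near {K : Type*} [NormedField K] (δ : ℝ) (x y : K) : Prop where
  left : ‖x‖ ≤ 1
  right : ‖y‖ ≤ 1
  sub : ‖x - y‖ ≤ δ

namespace Near

variable {K : Type*} [NormedField K] {δ : ℝ} {x y z x' y' : K}

theorem refl (hδ : 0 ≤ δ) (hx : ‖x‖ ≤ 1) : Near δ x x := ⟨hx, hx, by simpa using hδ⟩

theorem neg (h : Near δ x y) : Near δ (-x) (-y) :=
  ⟨(norm_neg x).trans_le h.left, (norm_neg y).trans_le h.right, by
    rw [← neg_sub_neg, neg_neg, neg_neg, norm_sub_rev]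
    exact h.sub⟩

variable [IsUltrametricDist K]

theorem trans (h : Near δ x y) (h' : Near δ y z) : Near δ x z :=
  ⟨h.left, h'.right, by
    rw [← sub_add_sub_cancel x y z]
    exact (IsUltrametricDist.norm_add_le_max _ _).trans (max_le h.sub h'.sub)⟩

theorem mul (h : Near δ x y) (h' : Near δ x' y') : Near δ (x * x') (y * y') where
  left := by
    rw [norm_mul]
    exact mul_le_one₀ h.left (norm_nonneg _) h'.left
  right := by
    rw [norm_mul]
    exact mul_le_one₀ h.right (norm_nonneg _) h'.right
  sub := by
    have : x * x' - y * y' = (x - y) * x' + y * (x' - y') := by ring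
    rw [this]
    refine (IsUltrametricDist.norm_add_le_max _ _).trans (max_le ?_ ?_) <;> rw [norm_mul]
    · exact (mul_le_of_le_one_right (norm_nonneg _) h'.left).trans h.sub
    · exact (mul_le_of_le_one_left (norm_nonneg _) h.right).trans h'.sub

theorem pow (hδ : 0 ≤ δ) (h : Near δ x y) (n : ℕ) : Near δ (x ^ n) (y ^ n) := by
  induction n with
  | zero => simpa using refl hδ norm_one.le
  | succ n ih =>
    rw [pow_succ, pow_succ]
    exact ih.mul h

theorem add (h : Near δ x y) (h' : Near δ x' y') : Near δ (x + x') (y + y') where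
  left := (IsUltrametricDist.norm_add_le_max _ _).trans (max_le h.left h'.left)
  right := (IsUltrametricDist.norm_add_le_max _ _).trans (max_le h.right h'.right)
  sub := by
    rw [add_sub_add_comm]
    exact (IsUltrametricDist.norm_add_le_max _ _).trans (max_le h.sub h'.sub)

theorem norm_eq_one (hδ : δ < 1) (h : Near δ x y) (hy : ‖y‖ = 1) : ‖x‖ = 1 := by
  have h1 := h.sub.trans_lt hδ
  rw [← sub_add_cancel x y, IsUltrametricDist.norm_add_eq_max_of_norm_ne_norm (by rw [hy]; exact h1.ne),
    hy, max_eq_right h1.le]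

end Near

/-! ### The case `|z| = 1` -/

section UnitCircle

variable {F : Type u} [Field F] [Fintype F] {a b c : F[X]} {z : CInfty F}

local notation "q" => Fintype.card F
local notation "ι" => algebraMap F[X] (CInfty F)
local notation "T" => algebraMap F[X] (CInfty F) X
local notation "e" => latticeExp (latticeOf z)

theorem norm_algebraMap_le_div {p r : F[X]} (h : p.degree < r.degree) : ‖ι p‖ ≤ ‖ι r‖ / q := by
  have hq := one_lt_card_real F
  have hr : r ≠ 0 := by
    rintro rfl
    simp at h
  rcases eq_or_ne p 0 with rfl | hp
  · simp only [map_zero, norm_zero]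
    positivity
  rw [norm_algebraMap_polynomial hp, norm_algebraMap_polynomial hr, le_div_iff₀ (by linarith),
    ← pow_succ]
  exact pow_le_pow_right₀ hq.le (natDegree_lt_natDegree hp h)

theorem norm_algebraMap_C_le_one (s : F) : ‖ι (C s)‖ ≤ 1 := by
  rcases eq_or_ne s 0 with rfl | hs
  · simp
  · rw [norm_algebraMap_polynomial (C_ne_zero.2 hs), natDegree_C, pow_zero]

theorem degree_lt_of_norm_lt {p r : F[X]} (h : ‖ι p‖ < ‖ι r‖) : p.degree < r.degree := by
  by_contra! hle
  refine h.not_ge ?_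
  rcases eq_or_ne r 0 with rfl | hr
  · simp
  have hp : p ≠ 0 := by
    rintro rfl
    simp [hr] at hle
  rw [norm_algebraMap_polynomial hp, norm_algebraMap_polynomial hr]
  exact pow_le_pow_right₀ (one_lt_card_real F).le (natDegree_le_natDegree hle)

/-- On the unit circle the square of a reduced point is congruent to a constant. -/
theorem IsReducedEquation.exists_sq_near_constant (habc : IsReducedEquation a b c z) (h1 : ‖z‖ = 1) :
    ∃ s : F, ‖z ^ 2 - ι (C s)‖ ≤ 1 / (q : ℝ) := by
  have ha : 0 < ‖ι a‖ := (norm_nonneg _).trans_lt habc.norm_lt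
  have ha0 : ι a ≠ 0 := norm_pos_iff.1 ha
  have hc : ‖ι c‖ ≤ ‖ι a‖ := by
    have : ι c = -(ι a * z ^ 2 + ι b * z) := by linear_combination habc.equation
    rw [this, norm_neg]
    refine (IsUltrametricDist.norm_add_le_max _ _).trans (max_le ?_ ?_)
    · rw [norm_mul, norm_pow, h1, one_pow, mul_one]
    · rw [norm_mul, h1, mul_one]
      exact habc.norm_lt.le
  have hdeg : c.degree = a.degree := by
    refine le_antisymm (not_lt.1 fun h => ?_) (not_lt.1 fun h => ?_)
    · have := norm_algebraMap_le_div h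
      have hq := one_lt_card_real F
      rw [le_div_iff₀ (by linarith)] at this
      nlinarith
    · have := norm_algebraMap_le_div h
      have hq := one_lt_card_real F
      rw [le_div_iff₀ (by linarith)] at this
      nlinarith [habc.norm_le]
  have ha' : a ≠ 0 := habc.monic.ne_zero
  have hc' : c ≠ 0 := by
    rintro rfl
    exact ha' (degree_eq_bot.1 (by simpa using hdeg.symm))
  have hlc : c.leadingCoeff ≠ 0 := leadingCoeff_ne_zero.2 hc'
  have hrem : (c - C c.leadingCoeff * a).degree < a.degree := by
    rw [← hdeg]
    refine degree_sub_lt_left ?_ hc' ?_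
    · rw [degree_C_mul hlc, hdeg]
    · rw [leadingCoeff_mul, leadingCoeff_C, habc.monic.leadingCoeff, mul_one]
  -- Here `c` and `a` have the same degree and `a` is monic, so `c / a` is congruent to the leading
  -- coefficient of `c`, while `b z / a` is small.
  refine ⟨-c.leadingCoeff, ?_⟩
  have h2 : z ^ 2 - ι (C (-c.leadingCoeff)) =
      -(ι b * z + ι (c - C c.leadingCoeff * a)) / ι a := by
    rw [eq_div_iff ha0]
    simp only [map_sub, map_mul, map_neg]
    linear_combination habc.equation
  rw [h2, norm_div, norm_neg, div_le_iff₀ ha, one_div_mul_eq_div]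
  refine (IsUltrametricDist.norm_add_le_max _ _).trans (max_le ?_ (norm_algebraMap_le_div hrem))
  rw [norm_mul, h1, mul_one]
  exact norm_algebraMap_le_div (degree_lt_of_norm_lt habc.norm_lt)

/-- If `s = t²`, then `z² - s = (z - t)(z + t)`, and orthogonality makes both factors at least `1`
in absolute value. -/
theorem IsReduced.not_isSquare_of_sq_near (hz : IsReduced F z) {s : F}
    (hs : ‖z ^ 2 - ι (C s)‖ < 1) : ¬IsSquare s := by
  rintro ⟨t, rfl⟩
  have h : ∀ t : F, 1 ≤ ‖z + ι (C t)‖ := fun t => by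
    have h2 := hz.norm_point (C t, 1)
    rw [latticePoint, map_one, one_mul, norm_one, one_mul, add_comm] at h2
    rw [h2]
    exact le_max_of_le_right hz.one_le
  have h3 : z ^ 2 - ι (C (t * t)) = (z + ι (C t)) * (z + ι (C (-t))) := by
    simp only [map_mul, map_neg]
    ring
  rw [h3, norm_mul] at hs
  exact hs.not_ge (one_le_mul_of_one_le_of_one_le (h t) (h (-t)))

theorem IsReduced.pow_near_neg_one (hz : IsReduced F z) (hq : Odd q) (h1 : ‖z‖ = 1) {s : F}
    (hs : ‖z ^ 2 - ι (C s)‖ ≤ 1 / (q : ℝ)) : Near (1 / (q : ℝ)) (z ^ (q - 1)) (-1) := by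
  have hlt := one_div_card_lt_one F
  have hns := hz.not_isSquare_of_sq_near (hs.trans_lt hlt)
  have hs0 : s ≠ 0 := by
    rintro rfl
    exact hns (IsSquare.zero)
  have hchar : ringChar F ≠ 2 := fun h => by
    rw [FiniteField.even_card_iff_char_two, ← Nat.even_iff] at h
    exact Nat.not_even_iff_odd.2 hq h
  have hpow : s ^ (q / 2) = -1 :=
    (FiniteField.pow_dichotomy hchar hs0).resolve_left fun h =>
      hns ((FiniteField.isSquare_iff hchar hs0).2 h)
  have hn : Near (1 / (q : ℝ)) (z ^ 2) (ι (C s)) :=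
    ⟨by rw [norm_pow, h1, one_pow], norm_algebraMap_C_le_one s, hs⟩
  have h2 := hn.pow (by positivity) (q / 2)
  rw [← pow_mul, ← map_pow, ← map_pow, hpow, map_neg, map_neg, map_one, map_one] at h2
  have h3 : 2 * (q / 2) = q - 1 := by
    have := Nat.two_mul_div_two_add_one_of_odd hq
    omega
  rwa [h3] at h2

/-- On the unit circle, `T ^ q` times `linePoly` is congruent to `z ^ q - z`. -/
theorem IsReduced.near_linePoly (hz : IsReduced F z) (h1 : ‖z‖ = 1) :
    Near (1 / (q : ℝ)) (T * e (1 / T)) 1 ∧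
      Near (1 / (q : ℝ)) (T ^ q * linePoly F (e (1 / T)) (e (z / T))) (z ^ q - z) := by
  have hT := hz.X_ne_zero
  have hlt := one_div_card_lt_one F
  have hpos : 0 < (q : ℝ) := zero_lt_one.trans (one_lt_card_real F)
  have hδ : 0 ≤ 1 / (q : ℝ) := by positivity
  -- The error in `e(x) ≈ x` is at most `|x|² = 1/q²`; multiplication by `T` leaves `1/q`.
  have key : ∀ y : CInfty F, ‖y‖ = 1 → Near (1 / (q : ℝ)) (T * e (y / T)) y := by
    intro y hy
    have hn : ‖y / T‖ = 1 / (q : ℝ) := by rw [norm_div, hy, hz.norm_X]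
    refine ⟨?_, hy.le, ?_⟩
    · rw [norm_mul, hz.norm_latticeExp_of_lt_one (by rwa [hn]), hn, hz.norm_X,
        mul_one_div_cancel hpos.ne']
    · have h2 := hz.norm_latticeExp_sub_le (x := y / T) (by rw [hn]; exact hlt.le)
      have h3 : T * e (y / T) - y = T * (e (y / T) - y / T) := by
        rw [mul_sub, mul_div_cancel₀ _ hT]
      rw [hn] at h2
      rw [h3, norm_mul, hz.norm_X]
      calc (q : ℝ) * ‖e (y / T) - y / T‖ ≤ q * (1 / q * (1 / q)) :=
            mul_le_mul_of_nonneg_left h2 hpos.le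
        _ = 1 / q := by field_simp
  have k1 := key 1 norm_one
  have k2 := key z h1
  refine ⟨k1, ?_⟩
  have h2 : T ^ q * linePoly F (e (1 / T)) (e (z / T)) =
      (T * e (z / T)) ^ q + -((T * e (1 / T)) ^ (q - 1) * (T * e (z / T))) := by
    have h3 : T ^ q = T ^ (q - 1) * T := by rw [← pow_succ, card_sub_one_add_one]
    rw [linePoly, mul_pow, mul_pow, mul_sub]
    nth_rewrite 2 [h3]
    ring
  rw [h2]
  have h4 := (k2.pow hδ q).add ((k1.pow hδ (q - 1)).mul k2).neg
  rwa [one_pow, one_mul, ← sub_eq_add_neg (z ^ q)] at h4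

/-- From `z^(q-1) ≡ -1` follows `T^q L ≡ z^q - z ≡ -2z`, whose power `q - 1` is `≡ -1`, whereas `(T
w₁)^(q(q-1)) ≡ 1`. The sum `T^(q(q-1)) N` is thus at most `1/q`, while `T^q L` is a unit, so `|Δ|`
is known exactly. -/
theorem IsReducedEquation.norm_le_of_norm_eq_one (habc : IsReducedEquation a b c z)
    (hz : IsReduced F z) (hq : Odd q) (h1 : ‖z‖ = 1) :
    linePoly F (e (1 / T)) (e (z / T)) ≠ 0 ∧
      ‖(e (1 / T) ^ (q - 1)) ^ q + linePoly F (e (1 / T)) (e (z / T)) ^ (q - 1)‖ ^ (q + 1) *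
          ‖planeDelta F T (e (1 / T)) (e (z / T))‖ ^ q ≤ 1 / (q : ℝ) := by
  have hlt := one_div_card_lt_one F
  have hpos : 0 < (q : ℝ) := zero_lt_one.trans (one_lt_card_real F)
  have hδ : 0 ≤ 1 / (q : ℝ) := by positivity
  obtain ⟨s, hs⟩ := habc.exists_sq_near_constant h1
  have hzq := hz.pow_near_neg_one hq h1 hs
  obtain ⟨n1, nD⟩ := hz.near_linePoly h1
  have nz : Near (1 / (q : ℝ)) z z := Near.refl hδ h1.le
  have nD2 : Near (1 / (q : ℝ)) (z ^ q - z) (-2 * z) := by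
    have h := (hzq.mul nz).add nz.neg
    rwa [← pow_succ, card_sub_one_add_one, ← sub_eq_add_neg, show -1 * z + -z = -2 * z by ring] at h
  have hchar : (-2 : F) ≠ 0 := by
    refine neg_ne_zero.2 (Ring.two_ne_zero fun h => ?_)
    rw [FiniteField.even_card_iff_char_two, ← Nat.even_iff] at h
    exact Nat.not_even_iff_odd.2 hq h
  have h2 : (-2 : CInfty F) ^ (q - 1) = 1 := by
    have h := congrArg (algebraMap F (CInfty F)) (FiniteField.pow_card_sub_one_eq_one (-2 : F) hchar)
    rwa [map_pow, map_neg, map_ofNat, map_one] at h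
  set D := linePoly F (e (1 / T)) (e (z / T)) with hD
  have nE : Near (1 / (q : ℝ)) ((T ^ q * D) ^ (q - 1)) (-1) := by
    have h := (nD.trans nD2).pow hδ (q - 1)
    rw [mul_pow (-2 : CInfty F), h2, one_mul] at h
    exact h.trans hzq
  have hE1 : ‖(T ^ q * D) ^ (q - 1)‖ = 1 := nE.norm_eq_one hlt (by rw [norm_neg, norm_one])
  have nW : Near (1 / (q : ℝ)) (((T * e (1 / T)) ^ (q - 1)) ^ q + (T ^ q * D) ^ (q - 1)) 0 := by
    have h := ((n1.pow hδ (q - 1)).pow hδ q).add nE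
    rwa [one_pow, one_pow, add_neg_cancel] at h
  set N := (e (1 / T) ^ (q - 1)) ^ q + D ^ (q - 1) with hN
  have hTN : ((T * e (1 / T)) ^ (q - 1)) ^ q + (T ^ q * D) ^ (q - 1) = (T ^ q) ^ (q - 1) * N := by
    rw [hN, mul_pow, mul_pow, mul_pow, ← pow_mul, ← pow_mul, mul_comm (q - 1) q]
    ring
  set R : ℝ := ((q : ℝ) ^ q) ^ (q - 1) with hR
  have hRpos : 0 < R := by positivity
  have hTR : ‖(T ^ q) ^ (q - 1)‖ = R := by rw [norm_pow, norm_pow, hz.norm_X]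
  have hNle : ‖N‖ ≤ 1 / (q * R) := by
    have h := nW.sub
    rw [hTN, sub_zero, norm_mul, hTR] at h
    rw [le_div_iff₀ (by positivity)]
    calc ‖N‖ * (q * R) = q * (R * ‖N‖) := by ring
      _ ≤ q * (1 / q) := mul_le_mul_of_nonneg_left h hpos.le
      _ = 1 := mul_one_div_cancel hpos.ne'
  have hDn : R * ‖D ^ (q - 1)‖ = 1 := by rw [← hTR, ← norm_mul, ← mul_pow, hE1]
  refine ⟨fun h0 => ?_, ?_⟩
  · rw [h0, zero_pow (card_sub_one_ne_zero F), norm_zero, mul_zero] at hDn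
    exact zero_ne_one hDn
  have hΔ : ‖planeDelta F T (e (1 / T)) (e (z / T))‖ = (q : ℝ) ^ q * R := by
    have hDn' : ‖D ^ (q - 1)‖ = 1 / R := by
      rw [eq_div_iff hRpos.ne', mul_comm]
      exact hDn
    rw [planeDelta, ← hD, norm_div, norm_mul, hDn', norm_pow, hz.norm_latticeExp_one_div_X, hz.norm_X,
      div_pow, one_pow]
    have : (q : ℝ) ^ q = q ^ (q - 1) * q := by rw [← pow_succ, card_sub_one_add_one]
    rw [this]
    field_simp
  rw [hΔ]
  have hRq : R * (q : ℝ) ^ q = ((q : ℝ) ^ q) ^ q := by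
    rw [hR, ← pow_succ, card_sub_one_add_one]
  calc ‖N‖ ^ (q + 1) * ((q : ℝ) ^ q * R) ^ q
      ≤ (1 / (q * R)) ^ (q + 1) * ((q : ℝ) ^ q * R) ^ q := by gcongr
    _ = (((q : ℝ) ^ q) ^ q) / (q * (q ^ q * R)) := by
        rw [div_pow, one_pow, mul_pow, mul_pow, pow_succ R, pow_succ (q : ℝ) q]
        field_simp
    _ = 1 / q := by
        rw [mul_comm ((q : ℝ) ^ q) R, hRq]
        field_simp

end UnitCircle

/-! ### The case `|z| > 1` -/

section Growth

variable {F : Type u} [Field F] [Fintype F]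

local notation "q" => Fintype.card F
local notation "ι" => algebraMap F[X] (CInfty F)
local notation "T" => algebraMap F[X] (CInfty F) X

variable (F) in
/-- The absolute value of `e_z(z / T)` for `|z| = q ^ (m + 1) ρ`. -/
def growth (ρ : ℝ) : ℕ → ℝ
  | 0 => ρ
  | m + 1 => (q : ℝ) ^ q * growth ρ m ^ q

/-- This yields `|e(z/T)| > 1/q = |e(1/T)|`, so the terms in `e(z/T)` dominate. -/
theorem one_lt_card_mul_growth {ρ : ℝ} (hρ : 1 < q * ρ) (m : ℕ) : 1 < q * growth F ρ m := by
  have hq := one_lt_card_real F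
  induction m with
  | zero => exact hρ
  | succ m ih =>
    rw [growth, ← mul_pow]
    exact one_lt_mul_of_lt_of_le hq (one_le_pow₀ ih.le)

/-- The formula for `|j(z)|` in terms of `growth`. -/
theorem growth_eq_rpow {ρ B : ℝ} (hB : 0 ≤ B)
    (h0 : (q : ℝ) ^ q ^ 2 * ρ ^ (q * (q - 1)) = B ^ ((q : ℝ) * ρ)) (m : ℕ) :
    (q : ℝ) ^ q ^ 2 * growth F ρ m ^ (q * (q - 1)) = B ^ ((q : ℝ) ^ (m + 1) * ρ) := by
  induction m with
  | zero => rw [growth, h0, zero_add, pow_one]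
  | succ m ih =>
    -- Both sides are raised to the power `q`; on the left the constant matches because `q² + q²(q -
    -- 1) = q³`.
    have h1 : (q : ℝ) ^ (m + 1 + 1) * ρ = (q : ℝ) ^ (m + 1) * ρ * (q : ℕ) := by ring
    rw [h1, Real.rpow_mul hB, Real.rpow_natCast, ← ih, growth, mul_pow, mul_pow, ← pow_mul,
      ← pow_mul, ← pow_mul, ← pow_mul, ← mul_assoc, ← pow_add]
    congr 2
    · obtain ⟨n, hn⟩ : ∃ n, q = n + 1 := ⟨q - 1, (card_sub_one_add_one F).symm⟩
      rw [hn, Nat.add_sub_cancel]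
      ring
    · ring

theorem IsReduced.norm_eq_of_growth {z : CInfty F} (hz : IsReduced F z) {ρ : ℝ} (hρ : 1 < q * ρ)
    (hρ1 : ρ ≤ 1) {m : ℕ} (hm : ‖z‖ = q ^ (m + 1) * ρ) :
    linePoly F (latticeExp (latticeOf z) (1 / T)) (latticeExp (latticeOf z) (z / T)) ≠ 0 ∧
      ‖(latticeExp (latticeOf z) (1 / T) ^ (q - 1)) ^ q +
          linePoly F (latticeExp (latticeOf z) (1 / T)) (latticeExp (latticeOf z) (z / T)) ^
            (q - 1)‖ ^ (q + 1) *
        ‖planeDelta F T (latticeExp (latticeOf z) (1 / T)) (latticeExp (latticeOf z) (z / T))‖ ^ q =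
      (q : ℝ) ^ q ^ 2 * growth F ρ m ^ (q * (q - 1)) := by
  have hq := one_lt_card_real F
  have hpos : (0 : ℝ) < q := zero_lt_one.trans hq
  have hzq : ‖z‖ / q = q ^ m * ρ := by
    rw [hm, pow_succ]
    field_simp
  have hw₁ := hz.norm_latticeExp_one_div_X
  have hw₂ : ‖latticeExp (latticeOf z) (z / T)‖ = growth F ρ m :=
    hz.norm_latticeExp_z_div_X fun n hn => by
      rw [hzq]
      refine hz.boxNorm_eq_of_recursion (E := growth F ρ) hρ.le hρ1 rfl (fun _ => rfl) hn ?_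
      rw [← hzq]
      exact div_lt_self (zero_lt_one.trans_le hz.one_le) hq
  set w₁ := latticeExp (latticeOf z) (1 / T)
  set w₂ := latticeExp (latticeOf z) (z / T)
  set E := growth F ρ m
  have hE : 1 < q * E := one_lt_card_mul_growth hρ m
  have hE1 : 1 / (q : ℝ) < E := by
    rw [div_lt_iff₀ hpos, mul_comm]
    exact hE
  have hEpos : 0 < E := (one_div_pos.2 hpos).trans hE1
  have hq1 : q - 1 ≠ 0 := card_sub_one_ne_zero F
  have hD : ‖linePoly F w₁ w₂‖ = E ^ q := by
    have h1 : ‖w₁ ^ (q - 1) * w₂‖ < ‖w₂ ^ q‖ := by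
      rw [norm_mul, norm_pow, norm_pow, hw₁, hw₂]
      conv_rhs => rw [← card_sub_one_add_one F, pow_succ]
      exact mul_lt_mul_of_pos_right (pow_lt_pow_left₀ hE1 (by positivity) hq1) hEpos
    rw [linePoly, sub_eq_add_neg, IsUltrametricDist.norm_add_eq_max_of_norm_ne_norm
      (by rw [norm_neg]; exact h1.ne'), norm_neg, max_eq_left h1.le, norm_pow, hw₂]
  have hN : ‖(w₁ ^ (q - 1)) ^ q + linePoly F w₁ w₂ ^ (q - 1)‖ = E ^ (q * (q - 1)) := by
    have h1 : ‖(w₁ ^ (q - 1)) ^ q‖ < ‖linePoly F w₁ w₂ ^ (q - 1)‖ := by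
      rw [norm_pow, norm_pow, norm_pow, hw₁, hD, ← pow_mul, ← pow_mul, mul_comm (q - 1)]
      exact pow_lt_pow_left₀ hE1 (by positivity) (mul_ne_zero Fintype.card_ne_zero hq1)
    rw [IsUltrametricDist.norm_add_eq_max_of_norm_ne_norm h1.ne, max_eq_right h1.le, norm_pow, hD,
      ← pow_mul]
  refine ⟨norm_pos_iff.1 (by rw [hD]; positivity), ?_⟩
  have hΔ : ‖planeDelta F T w₁ w₂‖ = (q : ℝ) ^ q / E ^ (q * (q - 1)) := by
    have h2 : (q : ℝ) ^ q = q ^ (q - 1) * q := by rw [← pow_succ, card_sub_one_add_one]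
    rw [planeDelta, norm_div, norm_mul, norm_pow, norm_pow, hw₁, hD, hz.norm_X, ← pow_mul, h2,
      div_pow, one_pow]
    field_simp
  rw [hN, hΔ, div_pow, pow_succ _ q, ← pow_mul (q : ℝ), pow_two]
  field_simp

end Growth

end DrinfeldJ

end

/-! ### Parity of `deg d` and conclusion -/

theorem theorem3p3 (F : Type*) [Field F] [Fintype F] (hq : Odd (Fintype.card F))
    (a b c d : F[X]) (z sqrtd : DrinfeldJ.CInfty F)
    (hz : z ∈ DrinfeldJ.quadraticFundamentalDomain F)
    (habc : DrinfeldJ.IsReducedEquation a b c z)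
    (hd : d = b ^ 2 - 4 * a * c)
    (hsqrtd : sqrtd ^ 2 = algebraMap F[X] (DrinfeldJ.CInfty F) d)
    (hzd : z = (-algebraMap F[X] (DrinfeldJ.CInfty F) b + sqrtd) /
      (2 * algebraMap F[X] (DrinfeldJ.CInfty F) a)) :
    (∃! φ : DrinfeldJ.DrinfeldModule F 2, φ.IsAssociated (DrinfeldJ.latticeOf z)) ∧
      ∀ φ : DrinfeldJ.DrinfeldModule F 2, φ.IsAssociated (DrinfeldJ.latticeOf z) →
        (‖z‖ = 1 → ‖φ.j‖ ≤ 1 / (Fintype.card F : ℝ)) ∧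
        (1 < ‖z‖ → ‖φ.j‖ = DrinfeldJ.boundBase (Fintype.card F) d.natDegree ^ ‖z‖) := by
  have hred := habc.isReduced hq hz.1
  rcases hred.one_le.eq_or_lt with h1 | h1
  · obtain ⟨hD, hle⟩ := habc.norm_le_of_norm_eq_one hred hq h1.symm
    obtain ⟨hex, hj⟩ := hred.existsUnique_isAssociated hD
    exact ⟨hex, fun φ hφ => ⟨fun _ => (hj φ hφ).trans_le hle, fun h => absurd h1 h.ne⟩⟩
  have hc := DrinfeldJ.one_lt_card_real F
  set q := Fintype.card F with hqdef
  have hpos : (0 : ℝ) < q := zero_lt_one.trans hc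
  have ha0 : a ≠ 0 := habc.monic.ne_zero
  have hsq : (q : ℝ) ^ d.natDegree = (q ^ a.natDegree * ‖z‖) ^ 2 := by
    have h2 := congrArg norm habc.sqrt_discr_sq
    rw [norm_pow, habc.norm_sqrt_discr hq, ← hd, DrinfeldJ.norm_algebraMap_polynomial ha0] at h2
    rw [h2, DrinfeldJ.norm_algebraMap_polynomial]
    rintro rfl
    rw [map_zero, norm_zero] at h2
    have : 0 < ((q : ℝ) ^ a.natDegree * ‖z‖) ^ 2 := by positivity
    exact this.ne' h2
  -- Strictness, from `|z| > 1`, makes the exponent `m` below a natural number.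
  have hdeg : 2 * a.natDegree < d.natDegree := by
    rw [← pow_lt_pow_iff_right₀ hc, hsq, mul_pow, ← pow_mul, mul_comm a.natDegree]
    exact lt_mul_of_one_lt_right (by positivity) (one_lt_pow₀ h1 two_ne_zero)
  have key : ∃ (ρ : ℝ) (m : ℕ), 1 < q * ρ ∧ ρ ≤ 1 ∧ ‖z‖ = q ^ (m + 1) * ρ ∧
      (q : ℝ) ^ q ^ 2 * ρ ^ (q * (q - 1)) =
        DrinfeldJ.boundBase q d.natDegree ^ ((q : ℝ) * ρ) := by
    have hroot : ∀ x : ℝ, 0 ≤ x → (q ^ a.natDegree * x) ^ 2 = (q : ℝ) ^ d.natDegree → ‖z‖ = x := by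
      intro x hx h
      rw [hsq, sq_eq_sq₀ (by positivity) (by positivity)] at h
      exact (mul_left_cancel₀ (pow_ne_zero _ hpos.ne') h).symm
    rcases Nat.even_or_odd d.natDegree with he | ho
    · obtain ⟨k, hk⟩ := id he
      obtain ⟨m, rfl⟩ : ∃ m, k = a.natDegree + m + 1 := ⟨k - a.natDegree - 1, by omega⟩
      -- For even degree `|z|` is an integral power of `q`.
      refine ⟨1, m, by rwa [mul_one], le_rfl, hroot _ (by positivity) ?_, ?_⟩
      · rw [hk]
        ring
      · rw [DrinfeldJ.boundBase, if_pos he, mul_one, one_pow, mul_one, ← Real.rpow_mul hpos.le,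
          ← Real.rpow_natCast, Nat.cast_pow, pow_two]
    · obtain ⟨k, hk⟩ := id ho
      obtain ⟨m, rfl⟩ : ∃ m, k = a.natDegree + m := ⟨k - a.natDegree, by omega⟩
      have hs : √(q : ℝ) * √q = q := Real.mul_self_sqrt hpos.le
      have hs0 : 0 < √(q : ℝ) := Real.sqrt_pos.2 hpos
      have hs1 : 1 < √(q : ℝ) := Real.lt_sqrt_of_sq_lt (by simpa using hc)
      have hqs : (q : ℝ) * (1 / √q) = √q := by
        rw [mul_one_div, div_eq_iff hs0.ne', hs]
      -- For odd degree `|z| = q^(m + 1/2)`; the base identity becomes `q² - q(q-1)/2 = q(q+1)/2` in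
      -- the exponents of `q`.
      refine ⟨1 / √q, m, by rwa [hqs], (div_le_one hs0).2 hs1.le, hroot _ (by positivity) ?_, ?_⟩
      · have h3 : (q : ℝ) ^ (m + 1) * (1 / √q) = q ^ m * √q := by rw [pow_succ, mul_assoc, hqs]
        rw [h3, hk]
        calc ((q : ℝ) ^ a.natDegree * (q ^ m * √q)) ^ 2
            = ((q : ℝ) ^ a.natDegree * q ^ m) ^ 2 * (√q * √q) := by ring
          _ = (q : ℝ) ^ (2 * (a.natDegree + m) + 1) := by rw [hs]; ring
      · rw [DrinfeldJ.boundBase, if_neg (Nat.not_even_iff_odd.2 ho), hqs, ← Real.rpow_mul hpos.le]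
        have h4 : 1 / √(q : ℝ) = (q : ℝ) ^ (-(1 / 2) : ℝ) := by
          rw [Real.rpow_neg hpos.le, ← Real.sqrt_eq_rpow, one_div]
        have h5 : √(q : ℝ) * (q + 1) / 2 * √q = q * (q + 1) / 2 := by
          linear_combination ((q : ℝ) + 1) / 2 * hs
        rw [h4, h5, ← Real.rpow_mul_natCast hpos.le, ← Real.rpow_natCast, ← Real.rpow_add hpos]
        congr 1
        have h6 : ((q - 1 : ℕ) : ℝ) = q - 1 := by
          rw [Nat.cast_sub Fintype.card_pos, Nat.cast_one]
        push_cast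
        rw [h6]
        ring
  obtain ⟨ρ, m, hρ, hρ1, hm, hB⟩ := key
  obtain ⟨hD, heq⟩ := hred.norm_eq_of_growth hρ hρ1 hm
  obtain ⟨hex, hj⟩ := hred.existsUnique_isAssociated hD
  refine ⟨hex, fun φ hφ => ⟨fun h => absurd h h1.ne', fun _ => ?_⟩⟩
  rw [hj φ hφ, heq, hm]
  refine DrinfeldJ.growth_eq_rpow ?_ hB m
  rw [DrinfeldJ.boundBase]
  split_ifs <;> positivity
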